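/- Let $\mathcal H$ be the upper half-plane. All functions $f(\tau,z)$ on $\mathcal H\times\mathbb C$ below are considered for $z\notin\mathbb Z+\tau\mathbb Z$. Call $f$ \emph{singular} if: for every $\tau$, $z\mapsto f(\tau,z)$ is $1$-periodic and meromorphic on $\mathbb C$ with no poles outside $\mathbb Z+\tau\mathbb Z$, the orders of the poles being bounded by a constant that does not depend on $\tau$ or on the pole; $f(\tau+1,z)=f(\tau,z)$; and every Laurent coefficient of $z\mapsto f(\tau,z)$ at $z=0$ is a holomorphic function of $\tau\in\mathcal H$ with a Fourier expansion $\sum_{r\ge 0}b(r)e^{2\pi i r\tau}$. For $A=\left(\begin{pmatrix}a&b\\c&d\end{pmatrix},(\lambda,\mu)\right)\in\mathrm{SL}(2,\mathbb Z)\ltimes\mathbb Z^2$ and an integer $k\ge 0$, put $$(f|_kA)(\tau,z)=(c\tau+d)^{-k}f\left(\frac{a\tau+b}{c\tau+d},\frac{z+\lambda\tau+\mu}{c\tau+d}\right),\quad X(A)=\frac{c}{c\tau+d},\quad Y(A)=\frac{cz+c\mu-d\lambda}{c\tau+d}.$$ A singular Jacobi form (of index zero) of weight $k$ is a singular function $f$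 with $f|_kA=f$ for all $A$; the set of these is denoted $\mathrm{JS}_k$. For integers $s_1,s_2\ge 0$, let $\mathrm{JS}_k^{\le s_1,s_2}$ be the set of singular functions $f$ for which there are singular functions $f_{j_1,j_2}$ ($0\le j_1\le s_1$, $0\le j_2\le s_2$) such that $f|_kA=\sum_{j_1=0}^{s_1}\sum_{j_2=0}^{s_2}f_{j_1,j_2}X(A)^{j_1}Y(A)^{j_2}$ for all $A$. Let $$e_2(\tau)=\frac{\pi^2}{3}\Bigl(1-24\sum_{n\ge1}\sigma_1(n)e^{2\pi i n\tau}\Bigr),\qquad E_1(\tau,z)=\lim_{N\to\infty}\sum_{n=-N}^{N}\ \lim_{M\to\infty}\sum_{m=-M}^{M}\frac1{z+m+n\tau},$$ $\partial_\tau=\frac{\pi}{2i}\frac{\partial}{\partial\tau}$ and $\partial_z=\frac{\partial}{\partial z}$. The Oberdieck derivation is given on forms of weight $k$ by $$\mathrm{Ob}^*(f)=4\,\partial_\tau f+E_1\,\partial_z f-k\,e_2f .$$ \textbf{Proposition 28.} Let $k,s_1,s_2\ge 0$ be integers. (1) Every $f\in\mathrm{JS}_k^{\le s_1,s_2}$ has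 complex partial derivatives in $\tau$ and in $z$ at every point $(\tau,z)$ with $z\notin\mathbb Z+\tau\mathbb Z$, and $\mathrm{Ob}^*(f)\in\mathrm{JS}_{k+2}^{\le s_1+1,s_2}$. (2) Every $f\in\mathrm{JS}_k$ has these partial derivatives, and $\mathrm{Ob}^*(f)\in\mathrm{JS}_{k+2}$. -/

import Mathlib

open scoped UpperHalfPlane MatrixGroups Topology Manifold

noncomputable section

namespace QuasiJacobi

/-! Functions on `ℍ × ℂ` that are meromorphic in `z` with poles in the lattice `ℤ + τℤ` are
modelled by curried functions `ℍ → ℂ → ℂ`. Their values at the points of the lattice are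
irrelevant: every condition below only looks at points off the lattice. -/

/-- The lattice `ℤ + τℤ`. -/
def lattice (τ : ℍ) : Set ℂ :=
  {w | ∃ m n : ℤ, w = (m : ℂ) + (n : ℂ) * (τ : ℂ)}

/-- `a` is the family of Laurent coefficients at `0` of a function meromorphic at `0`. -/
def HasLaurentExpansionAtZero (g : ℂ → ℂ) (a : ℤ → ℂ) : Prop :=
  (∃ N : ℕ, ∀ n : ℤ, n < -(N : ℤ) → a n = 0) ∧
    ∀ᶠ z in 𝓝[≠] (0 : ℂ), HasSum (fun n : ℤ => a n * z ^ n) (g z)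

/-- `A` is holomorphic on `ℍ` and at infinity, with a Fourier expansion
`A(τ) = ∑_{r ≥ 0} b(r) exp(2πirτ)`. -/
def HolomorphicAtInfinity (A : ℍ → ℂ) : Prop :=
  MDifferentiable 𝓘(ℂ) 𝓘(ℂ) A ∧
    ∃ b : ℕ → ℂ, ∀ τ : ℍ,
      HasSum (fun r : ℕ => b r * Complex.exp (2 * Real.pi * Complex.I * r * (τ : ℂ))) (A τ)

/-- Singular functions. -/
structure IsSingular (f : ℍ → ℂ → ℂ) : Prop where
  /-- no poles off the lattice -/
  analyticAt : ∀ (τ : ℍ) (z : ℂ), z ∉ lattice τ → AnalyticAt ℂ (f τ) z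
  /-- at most poles at the points of the lattice, of order bounded independently of the point
  and of `τ` -/
  poles : ∃ N : ℕ, ∀ (τ : ℍ) (w : ℂ), w ∈ lattice τ →
    MeromorphicAt (f τ) w ∧ ((-(N : ℤ) : ℤ) : WithTop ℤ) ≤ meromorphicOrderAt (f τ) w
  /-- `1`-periodicity in `z` -/
  periodic_z : ∀ (τ : ℍ) (z : ℂ), z ∉ lattice τ → f τ (z + 1) = f τ z
  /-- `1`-periodicity in `τ` -/
  periodic_tau : ∀ (τ : ℍ) (z : ℂ), z ∉ lattice τ → f ((1 : ℝ) +ᵥ τ) z = f τ z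
  /-- the Laurent coefficients at `z = 0` are holomorphic on `ℍ` and at infinity -/
  laurent : ∃ A : ℤ → ℍ → ℂ,
    (∀ τ : ℍ, HasLaurentExpansionAtZero (f τ) (fun n => A n τ)) ∧
      ∀ n : ℤ, HolomorphicAtInfinity (A n)

/-- The elements `((a b; c d), (l, m))` of the Jacobi group `SL(2, ℤ) ⋉ ℤ²`. -/
structure JacobiElt where
  /-- the component in `SL(2, ℤ)` -/
  g : SL(2, ℤ)
  /-- the first integer -/
  l : ℤ
  /-- the second integer -/
  m : ℤ

/-- `J(A)(τ, z) = cτ + d`. -/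
def J (A : JacobiElt) (τ : ℍ) : ℂ := (A.g 1 0 : ℂ) * τ + (A.g 1 1 : ℂ)

/-- `X(A)(τ, z) = c / (cτ + d)`. -/
def X (A : JacobiElt) (τ : ℍ) : ℂ := (A.g 1 0 : ℂ) / J A τ

/-- `Y(A)(τ, z) = (cz + cm - dl) / (cτ + d)`. -/
def Y (A : JacobiElt) (τ : ℍ) (z : ℂ) : ℂ :=
  ((A.g 1 0 : ℂ) * z + (A.g 1 0 : ℂ) * (A.m : ℂ) - (A.g 1 1 : ℂ) * (A.l : ℂ)) / J A τ

/-- The action of weight `k` and index zero: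
`(f|ₖA)(τ, z) = (cτ + d)⁻ᵏ f((aτ + b)/(cτ + d), (z + lτ + m)/(cτ + d))`. -/
def slash (k : ℕ) (f : ℍ → ℂ → ℂ) (A : JacobiElt) (τ : ℍ) (z : ℂ) : ℂ :=
  (J A τ ^ k)⁻¹ * f (A.g • τ) ((z + (A.l : ℂ) * (τ : ℂ) + (A.m : ℂ)) / J A τ)

/-- Singular Jacobi forms of index zero and weight `k`. -/
def JS (k : ℕ) : Set (ℍ → ℂ → ℂ) :=
  {f | IsSingular f ∧
    ∀ (A : JacobiElt) (τ : ℍ) (z : ℂ), z ∉ lattice τ → slash k f A τ z = f τ z}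

/-- Singular quasi-Jacobi forms of index zero, weight `k`, modular depth at most `s₁` and
elliptic depth at most `s₂`. -/
def JSLe (k s₁ s₂ : ℕ) : Set (ℍ → ℂ → ℂ) :=
  {f | IsSingular f ∧
    ∃ q : ℕ → ℕ → ℍ → ℂ → ℂ,
      (∀ j₁ ≤ s₁, ∀ j₂ ≤ s₂, IsSingular (q j₁ j₂)) ∧
      ∀ (A : JacobiElt) (τ : ℍ) (z : ℂ), z ∉ lattice τ →
        slash k f A τ z =
          ∑ j₁ ∈ Finset.range (s₁ + 1), ∑ j₂ ∈ Finset.range (s₂ + 1),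
            q j₁ j₂ τ z * X A τ ^ j₁ * Y A τ z ^ j₂}

/-- The Eisenstein function `e₂(τ) = (π² / 3) (1 - 24 ∑_{n ≥ 1} σ₁(n) exp(2πinτ))`. -/
def e2 (τ : ℍ) : ℂ :=
  (Real.pi : ℂ) ^ 2 / 3 *
    (1 - 24 * ∑' n : ℕ, (ArithmeticFunction.sigma 1 n : ℂ) *
      Complex.exp (2 * Real.pi * Complex.I * n * (τ : ℂ)))

/-- The shifted Eisenstein series of weight one, by Eisenstein summation:
`E₁(τ, z) = lim_N ∑_{n = -N}^{N} lim_M ∑_{m = -M}^{M} 1 / (z + m + nτ)`. -/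
def E1 (τ : ℍ) (z : ℂ) : ℂ :=
  ∑'[SummationFilter.symmetricIcc ℤ] n : ℤ, ∑'[SummationFilter.symmetricIcc ℤ] m : ℤ,
    1 / (z + (m : ℂ) + (n : ℂ) * (τ : ℂ))

/-- The function `t ↦ f(t, z)` of a complex variable `t` in the upper half-plane. -/
def tauSlice (f : ℍ → ℂ → ℂ) (z : ℂ) : ℂ → ℂ :=
  fun t => f (UpperHalfPlane.ofComplex t) z

/-- The normalised modular derivation `∂_τ = (π / (2i)) ∂/∂τ`. -/
def dTau (f : ℍ → ℂ → ℂ) (τ : ℍ) (z : ℂ) : ℂ :=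
  (Real.pi : ℂ) / (2 * Complex.I) * deriv (tauSlice f z) (τ : ℂ)

/-- The elliptic derivation `∂_z = ∂/∂z`. -/
def dZ (f : ℍ → ℂ → ℂ) (τ : ℍ) (z : ℂ) : ℂ := deriv (f τ) z

/-- The Oberdieck derivation on forms of weight `k`:
`Ob*(f) = 4 ∂_τ f + E₁ ∂_z f - k e₂ f`. -/
def oberdieck (k : ℕ) (f : ℍ → ℂ → ℂ) (τ : ℍ) (z : ℂ) : ℂ :=
  4 * dTau f τ z + E1 τ z * dZ f τ z - (k : ℂ) * e2 τ * f τ z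

/-- `f` has both complex partial derivatives at every point off the lattices, so that
`dTau f` and `dZ f` are genuine derivatives there. -/
def HasPartials (f : ℍ → ℂ → ℂ) : Prop :=
  ∀ (τ : ℍ) (z : ℂ), z ∉ lattice τ →
    DifferentiableAt ℂ (tauSlice f z) (τ : ℂ) ∧ DifferentiableAt ℂ (f τ) z

end QuasiJacobi

end

/-! The difficulty is regularity in `τ`. A singular function is meromorphic in `z` for each fixed
`τ`, but only its Laurent coefficients at `z = 0` are assumed holomorphic in `τ`; nothing links
different `τ` at other points. Ellipticity supplies the link. A singular function with `f(z + τ) =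
f(z)` is determined, up to a function of `τ`, by its polar part at `0`. Removing the leading pole
repeatedly with the `z`-derivatives of `E₁` (`E1Deriv`, explicit Lambert-type series that are
differentiable in both variables) ends in a function without poles, constant in `z` by Liouville. So
`f` is a combination of `1` and derivatives of `E₁` whose coefficients are Laurent data, holomorphic
in `τ` (`hasSingularPartials_of_quasiperiodic`). Hence `f` is jointly differentiable, with singular
derivatives.

The coefficients `f_{j₁,j₂}` of a quasi-Jacobi form are not elliptic. Since `X(A)` and `Y(A)` take
enough values to make the expansion unique, the polynomial `∑ f_{j₁,j₂} T^{j₂}` is moved by `z ↦ z +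
τ` to its translate by `T ↦ T - 1` (`coeffPoly_add_tau`). As `ε = E₁/(2πi)` satisfies `ε(z + τ) =
ε(z) - 1`, substituting `T ↦ T - ε` makes the coefficients elliptic, and substituting back gives the
originals as polynomials in `ε` (`hasSingularPartials_of_coeffPoly`). The element `A = 1` then
covers `f = f_{0,0}`.

The rest is algebra. `E₁` and `e₂` transform with additive errors `2πi Y(A)` and `-2πi X(A)`
(`E1_slash`, `e2_smul`), exactly the terms produced by differentiating the weight-`k` action in `τ`;
so `Ob*` commutes with the action (`slash_oberdieck`). Applied to the expansion of `f|A`, with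
`∂X/∂τ = -X²`, `∂Y/∂τ = -XY` and `∂Y/∂z = X`, it raises the degree in `X` by at most one and never
the degree in `Y` (`oberdieck_sum`). Part (2) is the invariant case: depth zero supplies the
regularity, and commutation supplies the invariance. -/

noncomputable section

namespace QuasiJacobi

open Complex Filter

/-! ### Functions holomorphic at infinity -/

/-- The exponential `w ↦ exp(2πiw)`. -/
def e (w : ℂ) : ℂ := Complex.exp (2 * Real.pi * Complex.I * w)

lemma e_add (v w : ℂ) : e (v + w) = e v * e w := by
  simp only [e, mul_add, Complex.exp_add]

lemma e_ne_zero (w : ℂ) : e w ≠ 0 := Complex.exp_ne_zero _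

lemma e_zero : e 0 = 1 := by simp [e]

lemma e_intCast (n : ℤ) : e n = 1 :=
  Complex.exp_eq_one_iff.2 ⟨n, by ring⟩

lemma e_eq_one_iff {w : ℂ} : e w = 1 ↔ ∃ n : ℤ, w = n := by
  refine ⟨fun h => ?_, fun ⟨n, hn⟩ => hn ▸ e_intCast n⟩
  obtain ⟨n, hn⟩ := Complex.exp_eq_one_iff.1 h
  refine ⟨n, mul_left_cancel₀ Complex.two_pi_I_ne_zero ?_⟩
  rw [hn]; ring

lemma e_neg (w : ℂ) : e (-w) = (e w)⁻¹ := by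
  rw [e, e, ← Complex.exp_neg]; ring_nf

lemma e_natCast_mul (n : ℕ) (w : ℂ) : e (n * w) = e w ^ n := by
  rw [e, e, ← Complex.exp_nat_mul]; ring_nf

lemma norm_e (w : ℂ) : ‖e w‖ = Real.exp (-(2 * Real.pi * w.im)) := by
  rw [e, Complex.norm_exp]
  congr 1
  simp [Complex.mul_re]

lemma hasDerivAt_e (w : ℂ) : HasDerivAt e (2 * Real.pi * Complex.I * e w) w := by
  have := ((hasDerivAt_id w).const_mul (2 * Real.pi * Complex.I)).cexp
  refine this.congr_deriv ?_
  simp [e, mul_comm]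

lemma norm_e_coe_lt_one (τ : ℍ) : ‖e τ‖ < 1 := by
  rw [norm_e, Real.exp_lt_one_iff]
  have := τ.im_pos
  have := Real.pi_pos
  simp only [UpperHalfPlane.coe_im, neg_lt_zero]
  positivity

lemma exists_coe_e_eq {q : ℂ} (h0 : q ≠ 0) (h1 : ‖q‖ < 1) : ∃ τ : ℍ, e τ = q := by
  have hq : Function.Periodic.qParam 1 (Function.Periodic.invQParam 1 q) = q :=
    Function.Periodic.qParam_right_inv one_ne_zero h0
  have him : 0 < (Function.Periodic.invQParam 1 q).im := by
    rw [Function.Periodic.im_invQParam]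
    have := Real.log_neg (norm_pos_iff.2 h0) h1
    have h2 : -1 / (2 * Real.pi) < 0 := div_neg_of_neg_of_pos (by norm_num) (by positivity)
    exact mul_pos_of_neg_of_neg h2 this
  refine ⟨⟨_, him⟩, ?_⟩
  conv_rhs => rw [← hq]
  simp [e, Function.Periodic.qParam]

lemma eventually_ofComplex (τ : ℍ) :
    ∀ᶠ t : ℂ in 𝓝 (τ : ℂ), ((UpperHalfPlane.ofComplex t : ℍ) : ℂ) = t := by
  filter_upwards [UpperHalfPlane.isOpen_upperHalfPlaneSet.mem_nhds τ.im_pos] with t ht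
  exact congrArg _ (UpperHalfPlane.ofComplex_apply_of_im_pos ht)

lemma hasSum_of_differentiableOn_ball {G : ℂ → ℂ} (hG : DifferentiableOn ℂ G (Metric.ball 0 1)) :
    ∃ b : ℕ → ℂ, ∀ q : ℂ, ‖q‖ < 1 → HasSum (fun n => b n * q ^ n) (G q) := by
  refine ⟨fun n => (n.factorial : ℂ)⁻¹ * iteratedDeriv n G 0, fun q hq => ?_⟩
  have := Complex.hasSum_taylorSeries_on_ball (r := 1) hG (z := q) (by simpa using hq)
  refine this.congr_fun fun n => ?_
  simp only [sub_zero, smul_eq_mul]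
  ring

lemma differentiableOn_ball_of_hasSum {G : ℂ → ℂ} {b : ℕ → ℂ}
    (h : ∀ q : ℂ, ‖q‖ < 1 → HasSum (fun n => b n * q ^ n) (G q)) :
    DifferentiableOn ℂ G (Metric.ball 0 1) := by
  have hs : HasFPowerSeriesOnBall G (FormalMultilinearSeries.ofScalars ℂ b) 0 1 := by
    refine ⟨?_, zero_lt_one, ?_⟩
    · refine ENNReal.le_of_forall_nnreal_lt fun r hr => ?_
      have hr1 : (r : ℝ) < 1 := by exact_mod_cast hr
      have := (h (r : ℂ) (by simpa using hr1)).summable.tendsto_atTop_zero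
      refine FormalMultilinearSeries.le_radius_of_tendsto _ (l := 0) ?_
      simpa using this.norm
    · intro y hy
      have hy : ‖y‖ < 1 := by simpa [← ENNReal.coe_one, Metric.eball_coe] using hy
      simpa [FormalMultilinearSeries.ofScalars_apply_eq, mul_comm] using h y hy
  have := hs.differentiableOn
  simpa [← ENNReal.coe_one, Metric.eball_coe] using this

/-- Since `e` maps `ℍ` onto the punctured unit disc, the Fourier series is a power series in `q`
converging on the whole disc. In terms of a function `G` on the disc, sums, products and derivatives
become immediate. -/
lemma holomorphicAtInfinity_iff {A : ℍ → ℂ} :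
    HolomorphicAtInfinity A ↔
      ∃ G : ℂ → ℂ, DifferentiableOn ℂ G (Metric.ball 0 1) ∧ ∀ τ : ℍ, A τ = G (e τ) := by
  have he : ∀ (r : ℕ) (τ : ℍ),
      Complex.exp (2 * Real.pi * Complex.I * r * (τ : ℂ)) = e τ ^ r := fun r τ => by
    rw [← e_natCast_mul, e]; ring_nf
  constructor
  · rintro ⟨-, b, hb⟩
    have key : ∀ q : ℂ, ‖q‖ < 1 → HasSum (fun n => b n * q ^ n) (∑' n, b n * q ^ n) := by
      intro q hq
      refine Summable.hasSum ?_
      -- The point `q = 0` is not of the form `e τ`; there only the constant term survives.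
      rcases eq_or_ne q 0 with rfl | h0
      · exact summable_of_ne_finset_zero (s := {0}) fun n hn => by
          simp at hn; simp [hn]
      · obtain ⟨τ, rfl⟩ := exists_coe_e_eq h0 hq
        simpa only [he] using (hb τ).summable
    refine ⟨fun q => ∑' n, b n * q ^ n, differentiableOn_ball_of_hasSum key, fun τ => ?_⟩
    have := hb τ
    simp only [he] at this
    exact this.tsum_eq.symm
  · rintro ⟨G, hG, hA⟩
    refine ⟨?_, ?_⟩
    · rw [UpperHalfPlane.mdifferentiable_iff]
      have : DifferentiableOn ℂ (fun t => G (e t)) {z | 0 < z.im} := by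
        refine hG.comp (fun t _ => (hasDerivAt_e t).differentiableAt.differentiableWithinAt) ?_
        intro t ht
        simpa using norm_e_coe_lt_one ⟨t, ht⟩
      refine this.congr fun t ht => ?_
      simp [hA, UpperHalfPlane.ofComplex_apply_of_im_pos ht]
    · obtain ⟨b, hb⟩ := hasSum_of_differentiableOn_ball hG
      refine ⟨b, fun τ => ?_⟩
      rw [hA]
      simpa only [he] using hb _ (norm_e_coe_lt_one τ)

namespace HolomorphicAtInfinity

lemma const (c : ℂ) : HolomorphicAtInfinity fun _ => c :=
  holomorphicAtInfinity_iff.2 ⟨fun _ => c, differentiableOn_const c, fun _ => rfl⟩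

lemma add {A B : ℍ → ℂ} (hA : HolomorphicAtInfinity A) (hB : HolomorphicAtInfinity B) :
    HolomorphicAtInfinity fun τ => A τ + B τ := by
  obtain ⟨G, hG, hA⟩ := holomorphicAtInfinity_iff.1 hA
  obtain ⟨H, hH, hB⟩ := holomorphicAtInfinity_iff.1 hB
  exact holomorphicAtInfinity_iff.2 ⟨_, hG.add hH, fun τ => by simp [hA, hB]⟩

lemma mul {A B : ℍ → ℂ} (hA : HolomorphicAtInfinity A) (hB : HolomorphicAtInfinity B) :
    HolomorphicAtInfinity fun τ => A τ * B τ := by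
  obtain ⟨G, hG, hA⟩ := holomorphicAtInfinity_iff.1 hA
  obtain ⟨H, hH, hB⟩ := holomorphicAtInfinity_iff.1 hB
  exact holomorphicAtInfinity_iff.2 ⟨_, hG.mul hH, fun τ => by simp [hA, hB]⟩

lemma sum {ι : Type*} (s : Finset ι) {A : ι → ℍ → ℂ}
    (hA : ∀ i ∈ s, HolomorphicAtInfinity (A i)) :
    HolomorphicAtInfinity fun τ => ∑ i ∈ s, A i τ := by
  classical
  induction s using Finset.induction_on with
  | empty => simpa using const 0
  | insert a s ha ih =>
    simp only [Finset.sum_insert ha]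
    exact (hA a (Finset.mem_insert_self _ _)).add
      (ih fun i hi => hA i (Finset.mem_insert_of_mem hi))

/-- By the chain rule the derivative is `2πi q G'(q)`, again holomorphic on the disc. -/
lemma exists_hasDerivAt {A : ℍ → ℂ} (hA : HolomorphicAtInfinity A) :
    ∃ B : ℍ → ℂ, HolomorphicAtInfinity B ∧
      ∀ τ : ℍ, HasDerivAt (fun t => A (UpperHalfPlane.ofComplex t)) (B τ) (τ : ℂ) := by
  obtain ⟨G, hG, hA⟩ := holomorphicAtInfinity_iff.1 hA
  refine ⟨fun τ => deriv G (e τ) * (2 * Real.pi * Complex.I * e τ),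
    holomorphicAtInfinity_iff.2 ⟨fun q => deriv G q * (2 * Real.pi * Complex.I * q),
      (hG.deriv Metric.isOpen_ball).mul (by fun_prop), fun _ => rfl⟩, fun τ => ?_⟩
  have h1 : HasDerivAt G (deriv G (e τ)) (e τ) :=
    (hG.differentiableAt (Metric.isOpen_ball.mem_nhds
      (by simpa using norm_e_coe_lt_one τ))).hasDerivAt
  refine (h1.comp (τ : ℂ) (hasDerivAt_e τ)).congr_of_eventuallyEq ?_
  filter_upwards [eventually_ofComplex τ] with t ht
  simp [hA, ht]

lemma vadd_one {A : ℍ → ℂ} (hA : HolomorphicAtInfinity A) (τ : ℍ) :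
    A ((1 : ℝ) +ᵥ τ) = A τ := by
  obtain ⟨G, -, hA⟩ := holomorphicAtInfinity_iff.1 hA
  have : e (1 : ℂ) = 1 := by exact_mod_cast e_intCast 1
  simp [hA, UpperHalfPlane.coe_vadd, e_add, this]

end HolomorphicAtInfinity

/-! ### The lattice -/

lemma mem_lattice_iff {τ : ℍ} {z : ℂ} :
    z ∈ lattice τ ↔ (∃ m : ℤ, z.re - z.im / τ.im * τ.re = m) ∧ ∃ n : ℤ, z.im / τ.im = n := by
  have h0 := τ.im_ne_zero
  constructor
  · rintro ⟨m, n, rfl⟩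
    have him : ((m : ℂ) + n * (τ : ℂ)).im / τ.im = n := by
      simp [Complex.mul_im, h0]
    refine ⟨⟨m, ?_⟩, ⟨n, him⟩⟩
    rw [him]
    simp [Complex.mul_re]
  · rintro ⟨⟨m, hm⟩, n, hn⟩
    refine ⟨m, n, Complex.ext ?_ ?_⟩
    · rw [hn] at hm
      simp [Complex.mul_re, ← hm]
    · rw [div_eq_iff h0] at hn
      simp [Complex.mul_im, hn]

lemma add_mem_lattice {τ : ℍ} {z w : ℂ} (hz : z ∈ lattice τ) (hw : w ∈ lattice τ) :
    z + w ∈ lattice τ := by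
  obtain ⟨m, n, rfl⟩ := hz
  obtain ⟨m', n', rfl⟩ := hw
  exact ⟨m + m', n + n', by push_cast; ring⟩

lemma neg_mem_lattice {τ : ℍ} {z : ℂ} (hz : z ∈ lattice τ) : -z ∈ lattice τ := by
  obtain ⟨m, n, rfl⟩ := hz
  exact ⟨-m, -n, by push_cast; ring⟩

lemma neg_mem_lattice_iff {τ : ℍ} {z : ℂ} : -z ∈ lattice τ ↔ z ∈ lattice τ :=
  ⟨fun h => by simpa using neg_mem_lattice h, neg_mem_lattice⟩

lemma add_mem_lattice_iff {τ : ℍ} {z w : ℂ} (hw : w ∈ lattice τ) :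
    z + w ∈ lattice τ ↔ z ∈ lattice τ :=
  ⟨fun h => by simpa using add_mem_lattice h (neg_mem_lattice hw), fun h => add_mem_lattice h hw⟩

lemma one_mem_lattice (τ : ℍ) : (1 : ℂ) ∈ lattice τ := ⟨1, 0, by simp⟩

lemma coe_mem_lattice (τ : ℍ) : (τ : ℂ) ∈ lattice τ := ⟨0, 1, by simp⟩

lemma zero_mem_lattice (τ : ℍ) : (0 : ℂ) ∈ lattice τ := ⟨0, 0, by simp⟩

lemma lattice_vadd_one (τ : ℍ) : lattice ((1 : ℝ) +ᵥ τ) = lattice τ := by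
  ext z
  constructor
  · rintro ⟨m, n, rfl⟩
    exact ⟨m + n, n, by push_cast [UpperHalfPlane.coe_vadd]; ring⟩
  · rintro ⟨m, n, rfl⟩
    exact ⟨m - n, n, by push_cast [UpperHalfPlane.coe_vadd]; ring⟩

/-- The points `(t, z)` with `t` in the upper half-plane and `z` off the lattice of `t`. -/
def offLattice : Set (ℂ × ℂ) :=
  {p | 0 < p.1.im ∧ p.2 ∉ lattice (UpperHalfPlane.ofComplex p.1)}

lemma coe_mem_offLattice {τ : ℍ} {z : ℂ} : ((τ : ℂ), z) ∈ offLattice ↔ z ∉ lattice τ := by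
  simp [offLattice, UpperHalfPlane.ofComplex_apply, τ.im_pos]

/-- The real coordinates of `z` in the basis `1, τ` depend continuously on `(τ, z)`, and lattice
points are those with coordinates in the closed set `ℤ × ℤ`. Joint openness is what allows
differentiation in `τ` with `z` fixed. -/
lemma isOpen_offLattice : IsOpen offLattice := by
  have hU : IsOpen {p : ℂ × ℂ | 0 < p.1.im} :=
    isOpen_lt continuous_const (Complex.continuous_im.comp continuous_fst)
  have hc : ContinuousOn
      (fun p : ℂ × ℂ => ((p.2.re - p.2.im / p.1.im * p.1.re, p.2.im / p.1.im) : ℝ × ℝ))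
      {p : ℂ × ℂ | 0 < p.1.im} := by
    have h1 : ContinuousOn (fun p : ℂ × ℂ => p.2.im / p.1.im) {p : ℂ × ℂ | 0 < p.1.im} :=
      ContinuousOn.div (by fun_prop) (by fun_prop) fun p hp => ne_of_gt hp
    exact ContinuousOn.prodMk (ContinuousOn.sub (by fun_prop)
      (h1.mul (by fun_prop))) h1
  have hZ : IsClosed (Set.range ((↑) : ℤ → ℝ) ×ˢ Set.range ((↑) : ℤ → ℝ)) :=
    Int.isClosedEmbedding_coe_real.isClosed_range.prod
      Int.isClosedEmbedding_coe_real.isClosed_range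
  have := hc.isOpen_inter_preimage hU hZ.isOpen_compl
  convert this using 1
  ext p
  simp only [offLattice, Set.mem_ofPred_eq, Set.mem_inter_iff, Set.mem_preimage, Set.mem_compl_iff,
    Set.mem_prod, Set.mem_range]
  refine and_congr_right fun hp => not_congr ?_
  rw [UpperHalfPlane.ofComplex_apply_of_im_pos hp, mem_lattice_iff]
  simp [eq_comm, UpperHalfPlane.im, UpperHalfPlane.re]

lemma isOpen_compl_lattice (τ : ℍ) : IsOpen (lattice τ)ᶜ := by
  have : (lattice τ)ᶜ = (fun z : ℂ => ((τ : ℂ), z)) ⁻¹' offLattice := by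
    ext z; simp [coe_mem_offLattice]
  rw [this]
  exact isOpen_offLattice.preimage (by fun_prop)

lemma eventually_notMem_lattice_tau {τ : ℍ} {z : ℂ} (hz : z ∉ lattice τ) :
    ∀ᶠ t : ℂ in 𝓝 (τ : ℂ), z ∉ lattice (UpperHalfPlane.ofComplex t) := by
  have : Tendsto (fun t : ℂ => (t, z)) (𝓝 (τ : ℂ)) (𝓝 ((τ : ℂ), z)) :=
    Continuous.tendsto (by fun_prop) _
  filter_upwards [this (isOpen_offLattice.mem_nhds (coe_mem_offLattice.2 hz))] with t ht
  exact ht.2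

lemma eventually_notMem_lattice_of_notMem {τ : ℍ} {z : ℂ} (hz : z ∉ lattice τ) :
    ∀ᶠ w : ℂ in 𝓝 z, w ∉ lattice τ :=
  (isOpen_compl_lattice τ).mem_nhds hz

lemma eventually_notMem_lattice_zero (τ : ℍ) : ∀ᶠ z in 𝓝[≠] (0 : ℂ), z ∉ lattice τ := by
  have h1 : ∀ᶠ z in 𝓝 (0 : ℂ), |z.im / τ.im| < 1 := by
    have : Continuous fun z : ℂ => |z.im / τ.im| := by fun_prop
    exact (this.tendsto 0).eventually_lt_const (by simp)
  have h2 : ∀ᶠ z in 𝓝 (0 : ℂ), |z.re - z.im / τ.im * τ.re| < 1 := by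
    have : Continuous fun z : ℂ => |z.re - z.im / τ.im * τ.re| := by fun_prop
    exact (this.tendsto 0).eventually_lt_const (by simp)
  filter_upwards [h1.filter_mono nhdsWithin_le_nhds, h2.filter_mono nhdsWithin_le_nhds,
    self_mem_nhdsWithin] with z hz1 hz2 hz0 hmem
  obtain ⟨⟨m, hm⟩, n, hn⟩ := mem_lattice_iff.1 hmem
  rw [hn] at hz1
  rw [hm] at hz2
  have hn0 : n = 0 := Int.abs_lt_one_iff.1 (by exact_mod_cast hz1)
  have hm0 : m = 0 := Int.abs_lt_one_iff.1 (by exact_mod_cast hz2)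
  rw [hn0, Int.cast_zero, div_eq_zero_iff, or_iff_left τ.im_ne_zero] at hn
  rw [hm0, hn] at hm
  exact hz0 (Complex.ext (by simpa using hm) (by simpa using hn))

lemma tendsto_sub_nhdsNE (w : ℂ) : Tendsto (fun z => z - w) (𝓝[≠] w) (𝓝[≠] 0) := by
  refine tendsto_nhdsWithin_of_tendsto_nhds_of_eventually_within _ ?_ ?_
  · have : Tendsto (fun z => z - w) (𝓝 w) (𝓝 (w - w)) := Continuous.tendsto (by fun_prop) _
    rw [sub_self] at this
    exact this.mono_left nhdsWithin_le_nhds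
  · filter_upwards [self_mem_nhdsWithin] with z hz
    simpa [sub_eq_zero] using hz

lemma eventually_notMem_lattice (τ : ℍ) (w : ℂ) : ∀ᶠ z in 𝓝[≠] w, z ∉ lattice τ := by
  by_cases hw : w ∈ lattice τ
  · filter_upwards [(tendsto_sub_nhdsNE w).eventually (eventually_notMem_lattice_zero τ)] with z hz
    rwa [← add_mem_lattice_iff hw, sub_add_cancel] at hz
  · exact (eventually_notMem_lattice_of_notMem hw).filter_mono nhdsWithin_le_nhds

lemma dense_compl_lattice (τ : ℍ) : Dense (lattice τ)ᶜ := by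
  intro w
  rw [mem_closure_iff_frequently]
  exact ((eventually_notMem_lattice τ w).frequently).filter_mono nhdsWithin_le_nhds

/-! ### The action of the Jacobi group -/

lemma J_eq_denom (A : JacobiElt) (τ : ℍ) : J A τ = UpperHalfPlane.denom A.g τ := by
  simp [J, UpperHalfPlane.denom]

lemma J_ne_zero (A : JacobiElt) (τ : ℍ) : J A τ ≠ 0 := by
  rw [J_eq_denom]
  exact UpperHalfPlane.denom_ne_zero _ _

lemma det_eq (g : SL(2, ℤ)) :
    (g 0 0 : ℂ) * (g 1 1 : ℂ) - (g 0 1 : ℂ) * (g 1 0 : ℂ) = 1 := by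
  have := g.det_coe
  rw [Matrix.det_fin_two] at this
  exact_mod_cast this

lemma coe_smul_eq (A : JacobiElt) (τ : ℍ) :
    ((A.g • τ : ℍ) : ℂ) = ((A.g 0 0 : ℂ) * τ + (A.g 0 1 : ℂ)) / J A τ := by
  rw [UpperHalfPlane.coe_specialLinearGroup_apply]
  simp [J]

lemma div_J_mem_lattice_iff (A : JacobiElt) (τ : ℍ) (z : ℂ) :
    z / J A τ ∈ lattice (A.g • τ) ↔ z ∈ lattice τ := by
  have hJ := J_ne_zero A τ
  have hdet := det_eq A.g
  constructor
  · rintro ⟨m, n, h⟩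
    rw [coe_smul_eq, div_eq_iff hJ, add_mul, mul_assoc, div_mul_cancel₀ _ hJ] at h
    refine ⟨m * A.g 1 1 + n * A.g 0 1, m * A.g 1 0 + n * A.g 0 0, ?_⟩
    rw [h, J]; push_cast; ring
  · rintro ⟨m, n, rfl⟩
    refine ⟨m * A.g 0 0 - n * A.g 0 1, n * A.g 1 1 - m * A.g 1 0, ?_⟩
    rw [coe_smul_eq, div_eq_iff hJ, add_mul, mul_assoc, div_mul_cancel₀ _ hJ, J]; push_cast
    linear_combination (-(m : ℂ) - n * τ) * hdet

lemma slash_arg_mem_lattice_iff (A : JacobiElt) (τ : ℍ) (z : ℂ) :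
    (z + (A.l : ℂ) * (τ : ℂ) + (A.m : ℂ)) / J A τ ∈ lattice (A.g • τ) ↔ z ∈ lattice τ := by
  rw [div_J_mem_lattice_iff, add_assoc, add_mem_lattice_iff]
  exact ⟨A.m, A.l, add_comm _ _⟩

/-! ### Laurent expansions at zero -/

lemma hasLaurentExpansionAtZero_of_analyticAt {g u : ℂ → ℂ} {N : ℕ} (hu : AnalyticAt ℂ u 0)
    (hg : ∀ᶠ z in 𝓝[≠] (0 : ℂ), g z = (z ^ N)⁻¹ * u z) :
    HasLaurentExpansionAtZero g fun n =>
      if -(N : ℤ) ≤ n then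
        ((n + N).toNat.factorial : ℂ)⁻¹ * iteratedDeriv (n + N).toNat u 0 else 0 := by
  refine ⟨⟨N, fun n hn => if_neg (not_le.2 hn)⟩, ?_⟩
  have h := hasFPowerSeriesAt_iff.1 hu.hasFPowerSeriesAt
  filter_upwards [hg, h.filter_mono nhdsWithin_le_nhds, self_mem_nhdsWithin] with z hz hs h0
  have h0 : z ≠ 0 := h0
  have hinj : Function.Injective fun k : ℕ => (k : ℤ) - N := fun a b h => by simpa using h
  rw [← hinj.hasSum_iff, hz]
  · rw [zero_add] at hs
    refine (hs.mul_left (z ^ N)⁻¹).congr_fun fun k => ?_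
    simp only [Function.comp, FormalMultilinearSeries.coeff_ofScalars, smul_eq_mul]
    rw [if_pos (by lia), zpow_sub₀ h0]
    simp only [sub_add_cancel, Int.toNat_natCast, zpow_natCast]
    ring
  · intro n hn
    rw [if_neg, zero_mul]
    intro hle
    exact hn ⟨(n + N).toNat, by simp; lia⟩

/-- Multiplying the difference of the two expansions by a power of `z` reduces this to uniqueness of
power series. It identifies the given Laurent coefficients with the Taylor coefficients of `z ^ N *
f`. -/
lemma HasLaurentExpansionAtZero.unique {g : ℂ → ℂ} {a b : ℤ → ℂ}
    (ha : HasLaurentExpansionAtZero g a) (hb : HasLaurentExpansionAtZero g b) : a = b := by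
  obtain ⟨⟨N, haN⟩, ha⟩ := ha
  obtain ⟨⟨M, hbM⟩, hb⟩ := hb
  set c : ℕ → ℂ := fun k => a ((k : ℤ) - (N + M : ℕ)) - b ((k : ℤ) - (N + M : ℕ)) with hc
  have hinj : Function.Injective fun k : ℕ => (k : ℤ) - (N + M : ℕ) := fun a b h => by
    simpa using h
  have hs : ∀ᶠ z in 𝓝[≠] (0 : ℂ), HasSum (fun k : ℕ => z ^ k * c k) 0 := by
    filter_upwards [ha, hb, self_mem_nhdsWithin] with z hza hzb h0
    have h0 : z ≠ 0 := h0
    have := hza.sub hzb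
    rw [sub_self, ← hinj.hasSum_iff] at this
    · have := this.mul_left (z ^ (N + M))
      rw [mul_zero] at this
      refine this.congr_fun fun k => ?_
      simp only [Function.comp, zpow_sub₀ h0, hc, zpow_natCast]
      field_simp
    · intro n hn
      have : n < -(N : ℤ) ∧ n < -(M : ℤ) := by
        by_contra hcon
        exact hn ⟨(n + (N + M : ℕ)).toNat, by simp; lia⟩
      rw [haN n this.1, hbM n this.2]; ring
  -- At `z = 0` the power series sums to `c 0`, not yet known to vanish. With this value `f` is
  -- analytic at `0`, and vanishing on a punctured neighbourhood forces it to vanish.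
  set f : ℂ → ℂ := fun z => if z = 0 then c 0 else 0 with hf
  have hp : HasFPowerSeriesAt f (FormalMultilinearSeries.ofScalars ℂ c) 0 := by
    rw [hasFPowerSeriesAt_iff]
    have := eventually_nhdsWithin_iff.1 hs
    filter_upwards [this] with z hz
    simp only [FormalMultilinearSeries.coeff_ofScalars, smul_eq_mul, zero_add]
    by_cases h0 : z = 0
    · subst h0
      have := hasSum_ite_eq (0 : ℕ) (c 0)
      rw [hf]
      simp only [if_true]
      refine this.congr_fun fun k => ?_
      rcases eq_or_ne k 0 with rfl | hk
      · simp
      · simp [hk]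
    · simpa [hf, h0] using hz h0
  have hf0 : f =ᶠ[𝓝 0] 0 := by
    refine hp.analyticAt.frequently_zero_iff_eventually_zero.1 ?_
    refine Eventually.frequently ?_
    filter_upwards [self_mem_nhdsWithin] with z hz
    exact if_neg hz
  have hp0 := HasFPowerSeriesAt.eq_zero (hp.congr hf0)
  have hc0 : ∀ k, c k = 0 := fun k => by
    have := congrArg (fun p => FormalMultilinearSeries.coeff p k) hp0
    rw [FormalMultilinearSeries.coeff_ofScalars] at this
    exact this
  ext n
  by_cases hn : -((N + M : ℕ) : ℤ) ≤ n
  · have := hc0 (n + (N + M : ℕ)).toNat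
    have h2 : (((n + (N + M : ℕ)).toNat : ℤ) - (N + M : ℕ)) = n := by lia
    simp only [hc] at this
    rw [h2] at this
    exact sub_eq_zero.1 this
  · rw [haN n (by lia), hbM n (by lia)]

lemma exists_analyticAt_of_neg_le_meromorphicOrderAt {g : ℂ → ℂ} {w : ℂ} {N : ℕ}
    (hg : MeromorphicAt g w) (hN : ((-(N : ℤ) : ℤ) : WithTop ℤ) ≤ meromorphicOrderAt g w) :
    ∃ u : ℂ → ℂ, AnalyticAt ℂ u w ∧ ∀ᶠ z in 𝓝[≠] w, g z = ((z - w) ^ N)⁻¹ * u z := by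
  by_cases htop : meromorphicOrderAt g w = ⊤
  · refine ⟨0, analyticAt_const, ?_⟩
    filter_upwards [meromorphicOrderAt_eq_top_iff.1 htop] with z hz
    simp [hz]
  · obtain ⟨k, hk⟩ := WithTop.ne_top_iff_exists.1 htop
    obtain ⟨u, hu, -, h⟩ := (meromorphicOrderAt_eq_int_iff hg).1 hk.symm
    rw [← hk] at hN
    have hkN : -(N : ℤ) ≤ k := by exact_mod_cast hN
    refine ⟨fun z => (z - w) ^ (k + N).toNat * u z, by fun_prop, ?_⟩
    filter_upwards [h, self_mem_nhdsWithin] with z hz h0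
    have h0 : z - w ≠ 0 := sub_ne_zero.2 h0
    rw [hz, smul_eq_mul, ← mul_assoc, ← zpow_natCast, ← zpow_natCast, ← zpow_neg, ← zpow_add₀ h0]
    congr 2
    lia

lemma neg_le_meromorphicOrderAt_of_analyticAt {g u : ℂ → ℂ} {w : ℂ} {N : ℕ}
    (hu : AnalyticAt ℂ u w) (h : ∀ᶠ z in 𝓝[≠] w, g z = ((z - w) ^ N)⁻¹ * u z) :
    MeromorphicAt g w ∧ ((-(N : ℤ) : ℤ) : WithTop ℤ) ≤ meromorphicOrderAt g w := by
  have hm : MeromorphicAt (fun z : ℂ => ((z - w) ^ N)⁻¹) w := by fun_prop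
  have hg : g =ᶠ[𝓝[≠] w] (fun z : ℂ => ((z - w) ^ N)⁻¹) * u := h
  refine ⟨(hm.mul hu.meromorphicAt).congr hg.symm, ?_⟩
  rw [meromorphicOrderAt_congr hg, meromorphicOrderAt_mul hm hu.meromorphicAt]
  have h1 : meromorphicOrderAt (fun z : ℂ => ((z - w) ^ N)⁻¹) w = ((-(N : ℤ) : ℤ) : WithTop ℤ) := by
    rw [meromorphicOrderAt_eq_int_iff hm]
    refine ⟨fun _ => 1, analyticAt_const, one_ne_zero, ?_⟩
    exact Eventually.of_forall fun z => by simp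
  rw [h1]
  exact le_add_of_nonneg_right hu.meromorphicOrderAt_nonneg

/-- Families of functions analytic at `0` whose Taylor coefficients are holomorphic on `ℍ` and at
infinity. -/
structure TaylorHolomorphic (u : ℍ → ℂ → ℂ) : Prop where
  analyticAt : ∀ τ, AnalyticAt ℂ (u τ) 0
  coeff : ∀ n, HolomorphicAtInfinity fun τ => iteratedDeriv n (u τ) 0

namespace TaylorHolomorphic

lemma add {u v : ℍ → ℂ → ℂ} (hu : TaylorHolomorphic u) (hv : TaylorHolomorphic v) :
    TaylorHolomorphic fun τ z => u τ z + v τ z := by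
  refine ⟨fun τ => (hu.analyticAt τ).add (hv.analyticAt τ), fun n => ?_⟩
  have : ∀ τ, iteratedDeriv n (fun z => u τ z + v τ z) 0
      = iteratedDeriv n (u τ) 0 + iteratedDeriv n (v τ) 0 := fun τ =>
    iteratedDeriv_fun_add (hu.analyticAt τ).contDiffAt (hv.analyticAt τ).contDiffAt
  simp only [this]
  exact (hu.coeff n).add (hv.coeff n)

lemma mul {u v : ℍ → ℂ → ℂ} (hu : TaylorHolomorphic u) (hv : TaylorHolomorphic v) :
    TaylorHolomorphic fun τ z => u τ z * v τ z := by
  refine ⟨fun τ => (hu.analyticAt τ).mul (hv.analyticAt τ), fun n => ?_⟩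
  have : ∀ τ, iteratedDeriv n (fun z => u τ z * v τ z) 0
      = ∑ i ∈ Finset.range (n + 1), (n.choose i : ℂ) * iteratedDeriv i (u τ) 0
        * iteratedDeriv (n - i) (v τ) 0 := fun τ =>
    iteratedDeriv_fun_mul (hu.analyticAt τ).contDiffAt (hv.analyticAt τ).contDiffAt
  simp only [this]
  exact HolomorphicAtInfinity.sum _ fun i _ =>
    ((HolomorphicAtInfinity.const _).mul (hu.coeff i)).mul (hv.coeff _)

lemma deriv {u : ℍ → ℂ → ℂ} (hu : TaylorHolomorphic u) :
    TaylorHolomorphic fun τ => deriv (u τ) := by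
  refine ⟨fun τ => (hu.analyticAt τ).deriv, fun n => ?_⟩
  simp only [← iteratedDeriv_succ']
  exact hu.coeff (n + 1)

lemma of_const {u : ℂ → ℂ} (hu : AnalyticAt ℂ u 0) : TaylorHolomorphic fun _ => u :=
  ⟨fun _ => hu, fun _ => HolomorphicAtInfinity.const _⟩

lemma of_holomorphicAtInfinity {A : ℍ → ℂ} (hA : HolomorphicAtInfinity A) :
    TaylorHolomorphic fun τ _ => A τ := by
  refine ⟨fun _ => analyticAt_const, fun n => ?_⟩
  rcases Nat.eq_zero_or_pos n with rfl | hn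
  · simpa using hA
  · simpa [iteratedDeriv_const, hn.ne'] using HolomorphicAtInfinity.const 0

end TaylorHolomorphic

/-! ### Closure properties of singular functions -/

namespace IsSingular

/-- Because the pole order is bounded uniformly in `τ`, one exponent `N` serves all `τ`. The Laurent
condition then becomes a condition on Taylor coefficients, which is stable under products by the
Leibniz rule; all closure properties go through this form and its converse `of_taylor`. -/
lemma exists_taylor {f : ℍ → ℂ → ℂ} (hf : IsSingular f) :
    ∃ (N : ℕ) (u : ℍ → ℂ → ℂ), TaylorHolomorphic u ∧
      ∀ τ, ∀ᶠ z in 𝓝[≠] (0 : ℂ), f τ z = (z ^ N)⁻¹ * u τ z := by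
  obtain ⟨N, hN⟩ := hf.poles
  obtain ⟨A, hA, hhol⟩ := hf.laurent
  have h : ∀ τ, ∃ u : ℂ → ℂ, AnalyticAt ℂ u 0 ∧
      ∀ᶠ z in 𝓝[≠] (0 : ℂ), f τ z = ((z - 0) ^ N)⁻¹ * u z := fun τ =>
    exists_analyticAt_of_neg_le_meromorphicOrderAt (hN τ 0 (zero_mem_lattice τ)).1
      (hN τ 0 (zero_mem_lattice τ)).2
  choose u hu hfu using h
  simp only [sub_zero] at hfu
  refine ⟨N, u, ⟨hu, fun n => ?_⟩, hfu⟩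
  have : ∀ τ, iteratedDeriv n (u τ) 0 = (n.factorial : ℂ) * A ((n : ℤ) - N) τ := fun τ => by
    have := congrFun ((hA τ).unique (hasLaurentExpansionAtZero_of_analyticAt (hu τ) (hfu τ)))
      ((n : ℤ) - N)
    rw [if_pos (by lia), sub_add_cancel, Int.toNat_natCast] at this
    rw [this, mul_inv_cancel_left₀ (by exact_mod_cast n.factorial_ne_zero)]
  simp only [this]
  exact (HolomorphicAtInfinity.const _).mul (hhol _)

lemma of_taylor {f : ℍ → ℂ → ℂ}
    (analyticAt : ∀ (τ : ℍ) (z : ℂ), z ∉ lattice τ → AnalyticAt ℂ (f τ) z)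
    (poles : ∃ N : ℕ, ∀ (τ : ℍ) (w : ℂ), w ∈ lattice τ →
      MeromorphicAt (f τ) w ∧ ((-(N : ℤ) : ℤ) : WithTop ℤ) ≤ meromorphicOrderAt (f τ) w)
    (periodic_z : ∀ (τ : ℍ) (z : ℂ), z ∉ lattice τ → f τ (z + 1) = f τ z)
    (periodic_tau : ∀ (τ : ℍ) (z : ℂ), z ∉ lattice τ → f ((1 : ℝ) +ᵥ τ) z = f τ z)
    (taylor : ∃ (N : ℕ) (u : ℍ → ℂ → ℂ), TaylorHolomorphic u ∧
      ∀ τ, ∀ᶠ z in 𝓝[≠] (0 : ℂ), f τ z = (z ^ N)⁻¹ * u τ z) : IsSingular f := by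
  refine ⟨analyticAt, poles, periodic_z, periodic_tau, ?_⟩
  obtain ⟨N, u, hu, h⟩ := taylor
  refine ⟨_, fun τ => hasLaurentExpansionAtZero_of_analyticAt (hu.analyticAt τ) (h τ), fun n => ?_⟩
  by_cases hn : -(N : ℤ) ≤ n
  · simpa only [if_pos hn] using (HolomorphicAtInfinity.const _).mul (hu.coeff _)
  · simpa only [if_neg hn] using HolomorphicAtInfinity.const 0

lemma congr {f g : ℍ → ℂ → ℂ} (hf : IsSingular f)
    (h : ∀ (τ : ℍ) (z : ℂ), z ∉ lattice τ → g τ z = f τ z) : IsSingular g := by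
  have h1 : ∀ (τ : ℍ) (w : ℂ), g τ =ᶠ[𝓝[≠] w] f τ := fun τ w => by
    filter_upwards [eventually_notMem_lattice τ w] with z hz using h τ z hz
  refine of_taylor (fun τ z hz => ?_) ?_ (fun τ z hz => ?_) (fun τ z hz => ?_) ?_
  · refine (hf.analyticAt τ z hz).congr ?_
    filter_upwards [eventually_notMem_lattice_of_notMem hz] with w hw using (h τ w hw).symm
  · obtain ⟨N, hN⟩ := hf.poles
    refine ⟨N, fun τ w hw => ?_⟩
    rw [meromorphicOrderAt_congr (h1 τ w)]
    exact ⟨(hN τ w hw).1.congr (h1 τ w).symm, (hN τ w hw).2⟩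
  · rw [h τ z hz, h τ (z + 1) (by rwa [add_mem_lattice_iff (one_mem_lattice τ)]),
      hf.periodic_z τ z hz]
  · rw [h τ z hz, h _ z (by rwa [lattice_vadd_one]), hf.periodic_tau τ z hz]
  · obtain ⟨N, u, hu, hfu⟩ := hf.exists_taylor
    refine ⟨N, u, hu, fun τ => ?_⟩
    filter_upwards [hfu τ, h1 τ 0] with z hz hz'
    rw [hz', hz]

lemma add {f g : ℍ → ℂ → ℂ} (hf : IsSingular f) (hg : IsSingular g) :
    IsSingular fun τ z => f τ z + g τ z := by
  refine of_taylor (fun τ z hz => (hf.analyticAt τ z hz).add (hg.analyticAt τ z hz)) ?_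
    (fun τ z hz => ?_) (fun τ z hz => ?_) ?_
  · obtain ⟨N, hN⟩ := hf.poles
    obtain ⟨M, hM⟩ := hg.poles
    refine ⟨N + M, fun τ w hw => ⟨(hN τ w hw).1.add (hM τ w hw).1, ?_⟩⟩
    refine le_trans ?_ (meromorphicOrderAt_add (hN τ w hw).1 (hM τ w hw).1)
    refine le_min (le_trans ?_ (hN τ w hw).2) (le_trans ?_ (hM τ w hw).2)
    · exact WithTop.coe_le_coe.2 (by push_cast; lia)
    · exact WithTop.coe_le_coe.2 (by push_cast; lia)
  · simp only [hf.periodic_z τ z hz, hg.periodic_z τ z hz]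
  · simp only [hf.periodic_tau τ z hz, hg.periodic_tau τ z hz]
  · obtain ⟨N, u, hu, hfu⟩ := hf.exists_taylor
    obtain ⟨M, v, hv, hgv⟩ := hg.exists_taylor
    refine ⟨N + M, fun τ z => z ^ M * u τ z + z ^ N * v τ z,
      ((TaylorHolomorphic.of_const (by fun_prop)).mul hu).add
        ((TaylorHolomorphic.of_const (by fun_prop)).mul hv), fun τ => ?_⟩
    filter_upwards [hfu τ, hgv τ, self_mem_nhdsWithin] with z hz hz' h0
    have h0 : z ≠ 0 := h0
    rw [hz, hz', pow_add]
    field_simp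

lemma mul {f g : ℍ → ℂ → ℂ} (hf : IsSingular f) (hg : IsSingular g) :
    IsSingular fun τ z => f τ z * g τ z := by
  refine of_taylor (fun τ z hz => (hf.analyticAt τ z hz).mul (hg.analyticAt τ z hz)) ?_
    (fun τ z hz => ?_) (fun τ z hz => ?_) ?_
  · obtain ⟨N, hN⟩ := hf.poles
    obtain ⟨M, hM⟩ := hg.poles
    refine ⟨N + M, fun τ w hw => ⟨(hN τ w hw).1.mul (hM τ w hw).1, ?_⟩⟩
    have := meromorphicOrderAt_mul (hN τ w hw).1 (hM τ w hw).1
    change _ ≤ meromorphicOrderAt (f τ * g τ) w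
    rw [this]
    refine le_trans (le_of_eq ?_) (add_le_add (hN τ w hw).2 (hM τ w hw).2)
    rw [← WithTop.coe_add]
    congr 1
    push_cast; ring
  · simp only [hf.periodic_z τ z hz, hg.periodic_z τ z hz]
  · simp only [hf.periodic_tau τ z hz, hg.periodic_tau τ z hz]
  · obtain ⟨N, u, hu, hfu⟩ := hf.exists_taylor
    obtain ⟨M, v, hv, hgv⟩ := hg.exists_taylor
    refine ⟨N + M, fun τ z => u τ z * v τ z, hu.mul hv, fun τ => ?_⟩
    filter_upwards [hfu τ, hgv τ] with z hz hz'
    rw [hz, hz', pow_add, mul_inv]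
    ring

lemma of_holomorphicAtInfinity {A : ℍ → ℂ} (hA : HolomorphicAtInfinity A) :
    IsSingular fun τ _ => A τ := by
  refine of_taylor (fun τ z hz => analyticAt_const) ⟨0, fun τ w hw => ?_⟩
    (fun τ z hz => rfl) (fun τ z hz => hA.vadd_one τ)
    ⟨0, _, TaylorHolomorphic.of_holomorphicAtInfinity hA, fun τ => by simp⟩
  exact ⟨analyticAt_const.meromorphicAt, by
    simpa using (analyticAt_const (v := A τ) (x := w) (𝕜 := ℂ)).meromorphicOrderAt_nonneg⟩

lemma const (c : ℂ) : IsSingular fun _ _ => c :=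
  of_holomorphicAtInfinity (HolomorphicAtInfinity.const c)

lemma const_mul {f : ℍ → ℂ → ℂ} (c : ℂ) (hf : IsSingular f) : IsSingular fun τ z => c * f τ z :=
  (const c).mul hf

lemma sub {f g : ℍ → ℂ → ℂ} (hf : IsSingular f) (hg : IsSingular g) :
    IsSingular fun τ z => f τ z - g τ z := by
  simpa [sub_eq_add_neg] using hf.add (hg.const_mul (-1))

lemma pow {f : ℍ → ℂ → ℂ} (hf : IsSingular f) (n : ℕ) : IsSingular fun τ z => f τ z ^ n := by
  induction n with
  | zero => simpa using const 1
  | succ n ih => simpa [pow_succ] using ih.mul hf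

lemma sum {ι : Type*} (s : Finset ι) {f : ι → ℍ → ℂ → ℂ} (hf : ∀ i ∈ s, IsSingular (f i)) :
    IsSingular fun τ z => ∑ i ∈ s, f i τ z := by
  classical
  induction s using Finset.induction_on with
  | empty => simpa using const 0
  | insert a s ha ih =>
    simp only [Finset.sum_insert ha]
    exact (hf a (Finset.mem_insert_self _ _)).add
      (ih fun i hi => hf i (Finset.mem_insert_of_mem hi))

end IsSingular

/-- The explicit numerator serves twice: the pole order grows by at most one, and the new numerator
is built from `u` and `deriv u`, so holomorphic Taylor coefficients persist. -/
lemma deriv_inv_pow_mul {u g : ℂ → ℂ} {w : ℂ} {N : ℕ} (hu : AnalyticAt ℂ u w)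
    (h : ∀ᶠ z in 𝓝[≠] w, g z = ((z - w) ^ N)⁻¹ * u z) :
    ∀ᶠ z in 𝓝[≠] w,
      deriv g z = ((z - w) ^ (N + 1))⁻¹ * ((z - w) * deriv u z - N * u z) := by
  have h' := eventually_eventually_nhdsWithin.2 h
  filter_upwards [h', hu.eventually_analyticAt.filter_mono nhdsWithin_le_nhds,
    self_mem_nhdsWithin] with z hz huz h0
  have h1 : g =ᶠ[𝓝 z] fun x => ((x - w) ^ N)⁻¹ * u x := by
    rwa [nhdsWithin_eq_nhds.2] at hz
    exact isOpen_compl_singleton.mem_nhds h0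
  have h0 : z - w ≠ 0 := sub_ne_zero.2 h0
  rw [h1.deriv_eq]
  have hd : HasDerivAt (fun x : ℂ => (x - w) ^ N) (N * (z - w) ^ (N - 1) * 1) z :=
    ((hasDerivAt_id z).sub_const w).pow N
  have := (hd.inv (pow_ne_zero N h0)).mul huz.differentiableAt.hasDerivAt
  refine this.deriv.trans ?_
  simp only [Pi.inv_apply]
  rcases N with _ | N
  · simp; field_simp
  · simp only [Nat.add_sub_cancel]
    field_simp
    ring

lemma IsSingular.dZ {f : ℍ → ℂ → ℂ} (hf : IsSingular f) : IsSingular (dZ f) := by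
  refine of_taylor (fun τ z hz => (hf.analyticAt τ z hz).deriv) ?_
    (fun τ z hz => ?_) (fun τ z hz => ?_) ?_
  · obtain ⟨N, hN⟩ := hf.poles
    refine ⟨N + 1, fun τ w hw => ?_⟩
    obtain ⟨u, hu, h⟩ := exists_analyticAt_of_neg_le_meromorphicOrderAt (hN τ w hw).1 (hN τ w hw).2
    exact neg_le_meromorphicOrderAt_of_analyticAt (by fun_prop) (deriv_inv_pow_mul hu h)
  · have h : (fun w => f τ (w + 1)) =ᶠ[𝓝 z] f τ := by
      filter_upwards [eventually_notMem_lattice_of_notMem hz] with w hw using hf.periodic_z τ w hw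
    rw [QuasiJacobi.dZ, QuasiJacobi.dZ, ← h.deriv_eq, deriv_comp_add_const]
  · refine Filter.EventuallyEq.deriv_eq ?_
    filter_upwards [eventually_notMem_lattice_of_notMem hz] with w hw using hf.periodic_tau τ w hw
  · obtain ⟨N, u, hu, hfu⟩ := hf.exists_taylor
    refine ⟨N + 1, fun τ z => z * deriv (u τ) z + (-N : ℂ) * u τ z,
      ((TaylorHolomorphic.of_const (by fun_prop)).mul hu.deriv).add
        ((TaylorHolomorphic.of_const (by fun_prop)).mul hu), fun τ => ?_⟩
    have := deriv_inv_pow_mul (w := 0) (N := N) (g := f τ) (hu.analyticAt τ) (by simpa using hfu τ)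
    filter_upwards [this] with z hz
    simp only [sub_zero] at hz
    rw [QuasiJacobi.dZ, hz]; ring

/-! ### The functions `ψ_b = (x d/dx)^b (x / (1 - x))` -/

/-- `ψ_b = (x d/dx)^b (x / (1 - x))`. -/
def psi : ℕ → ℂ → ℂ
  | 0 => fun x => x / (1 - x)
  | b + 1 => fun x => x * deriv (psi b) x

lemma analyticAt_psi (b : ℕ) {x : ℂ} (hx : x ≠ 1) : AnalyticAt ℂ (psi b) x := by
  induction b with
  | zero =>
    exact analyticAt_id.div (analyticAt_const.sub analyticAt_id) (sub_ne_zero.2 hx.symm)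
  | succ b ih => exact analyticAt_id.mul ih.deriv

lemma psi_zero (b : ℕ) : psi b 0 = 0 := by
  cases b <;> simp [psi]

lemma hasDerivAt_psi_e (b : ℕ) {w : ℂ} (hw : e w ≠ 1) :
    HasDerivAt (fun w => psi b (e w)) (2 * Real.pi * Complex.I * psi (b + 1) (e w)) w := by
  have h := (analyticAt_psi b hw).differentiableAt.hasDerivAt.comp w (hasDerivAt_e w)
  refine h.congr_deriv ?_
  simp only [psi]; ring

/-- As `ψ_b(0) = 0`, the quotient `ψ_b(x)/x` extends continuously to the closed disc of radius `r <
1` and is bounded there. This linear bound gives geometric convergence of the Lambert series. -/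
lemma exists_norm_psi_le (b : ℕ) {r : ℝ} (hr : r < 1) :
    ∃ C : ℝ, 0 ≤ C ∧ ∀ x : ℂ, ‖x‖ ≤ r → ‖psi b x‖ ≤ C * ‖x‖ := by
  have hd : DifferentiableOn ℂ (psi b) (Metric.ball 0 1) := fun x hx =>
    (analyticAt_psi b (fun h => by simp [h] at hx)).differentiableAt.differentiableWithinAt
  have hd' : ContinuousOn (dslope (psi b) 0) (Metric.closedBall 0 r) :=
    ((Complex.differentiableOn_dslope (Metric.ball_mem_nhds 0 one_pos)).2 hd).continuousOn.mono
      (Metric.closedBall_subset_ball hr)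
  obtain ⟨C, hC⟩ := (isCompact_closedBall (0 : ℂ) r).exists_bound_of_continuousOn hd'
  refine ⟨max C 0, le_max_right _ _, fun x hx => ?_⟩
  have h := sub_smul_dslope (psi b) 0 x
  rw [psi_zero, sub_zero, sub_zero] at h
  rw [← h, norm_smul, mul_comm]
  gcongr
  exact (hC x (by simpa using hx)).trans (le_max_left _ _)

lemma analyticAt_e (w : ℂ) : AnalyticAt ℂ e w :=
  (show Differentiable ℂ e from fun w => (hasDerivAt_e w).differentiableAt).analyticAt w

lemma exists_eq_add_mul_of_analyticAt {u : ℂ → ℂ} (hu : AnalyticAt ℂ u 0) :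
    AnalyticAt ℂ (dslope u 0) 0 ∧ ∀ z, u z = u 0 + z * dslope u 0 z := by
  obtain ⟨p, hp⟩ := hu
  refine ⟨⟨_, hp.has_fpower_series_dslope_fslope⟩, fun z => ?_⟩
  have := sub_smul_dslope u 0 z
  rw [sub_zero, smul_eq_mul] at this
  rw [this]; ring

/-- In the variable `v` the operator `x d/dx` is `(2πi)⁻¹ d/dv`. The simple pole `-1/(2πi v)` of
`e/(1 - e)` therefore differentiates to a single pole of order `b + 1`, with no lower polar terms.
-/
lemma exists_psi_e_eq_add (b : ℕ) :
    ∃ ρ : ℂ → ℂ, AnalyticAt ℂ ρ 0 ∧ ∀ᶠ v in 𝓝[≠] (0 : ℂ), psi b (e v) =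
      -((-1) ^ b * b.factorial / (2 * Real.pi * Complex.I) ^ (b + 1)) * (v ^ (b + 1))⁻¹ + ρ v := by
  have hne : ∀ᶠ v in 𝓝[≠] (0 : ℂ), e v ≠ 1 := by
    -- Any lattice `ℤ + τℤ` would do here, since it contains `ℤ`, where `e = 1`.
    filter_upwards [eventually_notMem_lattice_zero UpperHalfPlane.I] with v hv h
    obtain ⟨n, rfl⟩ := e_eq_one_iff.1 h
    exact hv ⟨n, 0, by simp⟩
  have hpi := Complex.two_pi_I_ne_zero
  induction b with
  | zero =>
    obtain ⟨hd, hed⟩ := exists_eq_add_mul_of_analyticAt (analyticAt_e 0)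
    have h0 : dslope e 0 0 = 2 * Real.pi * Complex.I := by
      rw [dslope_same, (hasDerivAt_e 0).deriv, e_zero, mul_one]
    obtain ⟨hh, heh⟩ := exists_eq_add_mul_of_analyticAt (hd.inv (by rw [h0]; exact hpi))
    refine ⟨fun v => -1 - dslope (dslope e 0)⁻¹ 0 v, by fun_prop, ?_⟩
    filter_upwards [hne, self_mem_nhdsWithin] with v hv hv0
    have hv0 : v ≠ 0 := hv0
    have h1 : dslope e 0 v ≠ 0 := fun hc => by
      rw [hed v, hc, mul_zero, add_zero, e_zero] at hv
      exact hv rfl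
    have h2 : psi 0 (e v) = -1 - (dslope e 0)⁻¹ v / v := by
      rw [Pi.inv_apply]
      simp only [psi]
      rw [hed v, e_zero]
      field_simp
      ring
    rw [h2, heh v, Pi.inv_apply, h0]
    simp
    field_simp
    ring
  | succ b ih =>
    obtain ⟨ρ, hρ, h⟩ := ih
    refine ⟨fun v => (2 * Real.pi * Complex.I)⁻¹ * deriv ρ v, by fun_prop, ?_⟩
    have h' : ∀ᶠ v in 𝓝[≠] (0 : ℂ), psi b (e v) - ρ v = ((v - 0) ^ (b + 1))⁻¹ *
        -((-1) ^ b * b.factorial / (2 * Real.pi * Complex.I) ^ (b + 1)) := by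
      filter_upwards [h] with v hv
      rw [hv, sub_zero]; ring
    filter_upwards [deriv_inv_pow_mul analyticAt_const h', hne,
      hρ.eventually_analyticAt.filter_mono nhdsWithin_le_nhds, self_mem_nhdsWithin]
      with v hv hv1 hρv hv0
    have hv0 : v ≠ 0 := hv0
    have hd := (hasDerivAt_psi_e b hv1).sub hρv.differentiableAt.hasDerivAt
    have := hd.deriv
    rw [show deriv (fun v => psi b (e v) - ρ v) v = _ from this, sub_eq_iff_eq_add] at hv
    rw [← mul_right_inj' hpi, hv, deriv_const, Nat.factorial_succ]
    push_cast
    field_simp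
    ring

lemma exists_psi_e_eq_inv_pow_mul (b : ℕ) :
    ∃ u : ℂ → ℂ, AnalyticAt ℂ u 0 ∧
      ∀ᶠ v in 𝓝[≠] (0 : ℂ), psi b (e v) = ((v - 0) ^ (b + 1))⁻¹ * u v := by
  obtain ⟨ρ, hρ, h⟩ := exists_psi_e_eq_add b
  refine ⟨fun v => -((-1) ^ b * b.factorial / (2 * Real.pi * Complex.I) ^ (b + 1)) +
    v ^ (b + 1) * ρ v, by fun_prop, ?_⟩
  filter_upwards [h, self_mem_nhdsWithin] with v hv hv0
  have hv0 : v ≠ 0 := hv0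
  rw [hv, sub_zero, mul_add, inv_mul_cancel_left₀ (pow_ne_zero _ hv0)]
  ring

/-! ### The series `∑_{n ≥ 1} n^a ψ_b(exp(2πi(σz + nt)))` -/

/-- The terms of `lambertSeries`. -/
def lambertTerm (a b : ℕ) (σ : ℂ) (n : ℕ) (p : ℂ × ℂ) : ℂ :=
  ((n : ℂ) + 1) ^ a * psi b (e (σ * p.2 + ((n : ℂ) + 1) * p.1))

/-- The series `∑_{n ≥ 1} n^a ψ_b(exp(2πi(σz + nτ)))`. -/
def lambertSeries (a b : ℕ) (σ : ℂ) (τ : ℍ) (z : ℂ) : ℂ :=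
  ∑' n : ℕ, lambertTerm a b σ n ((τ : ℂ), z)

/-- The linear form `(s, w) ↦ x s + y w`. -/
def linForm (x y : ℂ) : ℂ × ℂ →L[ℂ] ℂ :=
  x • ContinuousLinearMap.fst ℂ ℂ ℂ + y • ContinuousLinearMap.snd ℂ ℂ ℂ

@[simp] lemma linForm_apply (x y : ℂ) (p : ℂ × ℂ) : linForm x y p = x * p.1 + y * p.2 := by
  simp [linForm]

lemma norm_linForm_le (x y : ℂ) : ‖linForm x y‖ ≤ ‖x‖ + ‖y‖ := by
  refine ContinuousLinearMap.opNorm_le_bound _ (by positivity) fun p => ?_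
  rw [linForm_apply, add_mul]
  refine (norm_add_le _ _).trans ?_
  rw [norm_mul, norm_mul]
  gcongr
  · exact norm_fst_le p
  · exact norm_snd_le p

lemma hasSum_linForm {x y : ℕ → ℂ} {X Y : ℂ} (hx : HasSum x X) (hy : HasSum y Y) :
    HasSum (fun n => linForm (x n) (y n)) (linForm X Y) :=
  (hx.smul_const _).add (hy.smul_const _)

lemma hasFDerivAt_lambertTerm (a b : ℕ) (σ : ℂ) (n : ℕ) {p : ℂ × ℂ}
    (hp : e (σ * p.2 + ((n : ℂ) + 1) * p.1) ≠ 1) :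
    HasFDerivAt (lambertTerm a b σ n)
      (linForm (2 * Real.pi * Complex.I * lambertTerm (a + 1) (b + 1) σ n p)
        (2 * Real.pi * Complex.I * σ * lambertTerm a (b + 1) σ n p)) p := by
  have h1 : HasFDerivAt (fun p : ℂ × ℂ => σ * p.2 + ((n : ℂ) + 1) * p.1)
      (linForm ((n : ℂ) + 1) σ) p := by
    have := (linForm ((n : ℂ) + 1) σ).hasFDerivAt (x := p)
    refine this.congr_of_eventuallyEq (Eventually.of_forall fun q => ?_)
    simp [add_comm]
  have h2 := ((hasDerivAt_psi_e b hp).comp_hasFDerivAt p h1).const_mul (((n : ℂ) + 1) ^ a)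
  refine h2.congr_fderiv ?_
  ext <;> simp [lambertTerm] <;> ring

/-- On `Im τ ≥ η`, `‖z‖ ≤ B` the argument of `ψ_b` has modulus at most `exp(2πB) exp(-2πη)^(n+1)`.
From some `M` on it stays away from the pole at `1`, and the terms decay geometrically. The terms
before `M` may have poles and must be treated separately. -/
lemma exists_lambertTerm_bound (a b : ℕ) {η : ℝ} (hη : 0 < η) (B : ℝ) :
    ∃ (M : ℕ) (v : ℕ → ℝ), Summable v ∧ ∀ n ≥ M, ∀ (σ : ℂ) (p : ℂ × ℂ), ‖σ‖ ≤ 1 → η ≤ p.1.im →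
      ‖p.2‖ ≤ B → e (σ * p.2 + ((n : ℂ) + 1) * p.1) ≠ 1 ∧ ‖lambertTerm a b σ n p‖ ≤ v n := by
  -- Any radius in `(0, 1)` works: below it, the argument differs from `1` and the linear bound
  -- applies.
  obtain ⟨C, hC0, hC⟩ := exists_norm_psi_le b (r := 1 / 2) (by norm_num)
  set r : ℝ := Real.exp (-(2 * Real.pi * η)) with hr
  have hr0 : 0 < r := Real.exp_pos _
  have hr1 : r < 1 := by
    rw [hr, Real.exp_lt_one_iff]
    have := Real.pi_pos
    simp only [neg_lt_zero]; positivity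
  set D : ℝ := Real.exp (2 * Real.pi * B) with hD
  have hD0 : 0 < D := Real.exp_pos _
  have hbound : ∀ (n : ℕ) (σ : ℂ) (p : ℂ × ℂ), ‖σ‖ ≤ 1 → η ≤ p.1.im → ‖p.2‖ ≤ B →
      ‖e (σ * p.2 + ((n : ℂ) + 1) * p.1)‖ ≤ D * r ^ (n + 1) := by
    intro n σ p hσ hp1 hp2
    rw [norm_e, hD, hr, ← Real.exp_nat_mul, ← Real.exp_add, Real.exp_le_exp]
    have h1 : |(σ * p.2).im| ≤ B := by
      refine (Complex.abs_im_le_norm _).trans ?_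
      rw [norm_mul]
      calc ‖σ‖ * ‖p.2‖ ≤ 1 * B := by gcongr
        _ = B := one_mul B
    have h2 : (((n : ℂ) + 1) * p.1).im = (n + 1) * p.1.im := by
      simp [Complex.mul_im]
    rw [Complex.add_im, h2]
    have h3 : -B ≤ (σ * p.2).im := (abs_le.1 h1).1
    have h4 : ((n : ℝ) + 1) * η ≤ (n + 1) * p.1.im := by gcongr
    have hpi := Real.pi_pos
    push_cast
    nlinarith [mul_le_mul_of_nonneg_left (add_le_add h3 h4) (by positivity : 0 ≤ 2 * Real.pi)]
  have htend : Tendsto (fun n : ℕ => D * r ^ (n + 1)) atTop (𝓝 (D * 0)) :=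
    ((tendsto_pow_atTop_nhds_zero_of_lt_one hr0.le hr1).comp (tendsto_add_atTop_nat 1)).const_mul D
  rw [mul_zero] at htend
  obtain ⟨M, hM⟩ := eventually_atTop.1 (htend.eventually_le_const (by norm_num : (0 : ℝ) < 1 / 2))
  refine ⟨M, fun n => ((n : ℝ) + 1) ^ a * (C * (D * r ^ (n + 1))), ?_, ?_⟩
  · have h := summable_pow_mul_geometric_of_norm_lt_one a (r := r)
      (by rwa [Real.norm_of_nonneg hr0.le])
    have h := ((summable_nat_add_iff 1).2 h).mul_left (C * D)
    refine h.congr fun n => ?_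
    push_cast; ring
  · intro n hn σ p hσ hp1 hp2
    have h1 := hbound n σ p hσ hp1 hp2
    have h2 := h1.trans (hM n hn)
    refine ⟨fun h => by rw [h, norm_one] at h2; norm_num at h2, ?_⟩
    have hn1 : ‖(n : ℂ) + 1‖ = (n : ℝ) + 1 := by
      have : ((n : ℂ) + 1) = ((n + 1 : ℕ) : ℂ) := by push_cast; ring
      rw [this, Complex.norm_natCast]; push_cast; ring
    rw [lambertTerm, norm_mul, norm_pow, hn1]
    exact mul_le_mul_of_nonneg_left ((hC _ h2).trans (mul_le_mul_of_nonneg_left h1 hC0))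
      (by positivity)

lemma summable_lambertTerm (a b : ℕ) {σ : ℂ} (hσ : ‖σ‖ ≤ 1) {p : ℂ × ℂ} (hp : 0 < p.1.im) :
    Summable fun n => lambertTerm a b σ n p := by
  obtain ⟨M, v, hv, h⟩ := exists_lambertTerm_bound a b hp ‖p.2‖
  refine Summable.of_norm_bounded_eventually_nat hv ?_
  filter_upwards [eventually_ge_atTop M] with n hn using (h n hn σ p hσ le_rfl le_rfl).2

/-- The tail has no poles near `p₀`, so it may be differentiated term by term. Differentiation in
`τ` brings down a factor `n` and raises both `a` and `b`; differentiation in `z` raises only `b`. -/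
lemma exists_hasFDerivAt_lambertTail (a b : ℕ) {σ : ℂ} (hσ : ‖σ‖ ≤ 1) {p₀ : ℂ × ℂ}
    (hp₀ : 0 < p₀.1.im) :
    ∃ M : ℕ, ∀ᶠ p in 𝓝 p₀, HasFDerivAt (fun p => ∑' n, lambertTerm a b σ (n + M) p)
      (linForm (2 * Real.pi * Complex.I * ∑' n, lambertTerm (a + 1) (b + 1) σ (n + M) p)
        (2 * Real.pi * Complex.I * σ * ∑' n, lambertTerm a (b + 1) σ (n + M) p)) p := by
  have hη : 0 < p₀.1.im / 2 := by positivity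
  obtain ⟨M₁, v₁, hv₁, h₁⟩ := exists_lambertTerm_bound (a + 1) (b + 1) hη (‖p₀.2‖ + 1)
  obtain ⟨M₂, v₂, hv₂, h₂⟩ := exists_lambertTerm_bound a (b + 1) hη (‖p₀.2‖ + 1)
  obtain ⟨M, hM₁, hM₂⟩ : ∃ M, M₁ ≤ M ∧ M₂ ≤ M := ⟨max M₁ M₂, le_max_left _ _, le_max_right _ _⟩
  -- A convex neighbourhood of `p₀` on which `Im τ` is bounded below and `z` is bounded, as the
  -- uniform estimates require; convexity gives the connectedness needed for termwise
  -- differentiation.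
  obtain ⟨s, hs⟩ : ∃ s : Set (ℂ × ℂ), s =
    {q : ℂ | p₀.1.im / 2 < q.im} ×ˢ Metric.ball (0 : ℂ) (‖p₀.2‖ + 1) := ⟨_, rfl⟩
  have hso : IsOpen s := by
    rw [hs]
    exact (isOpen_lt continuous_const Complex.continuous_im).prod Metric.isOpen_ball
  have hsc : IsPreconnected s := by
    rw [hs]
    exact ((convex_halfSpace_im_gt _).prod (convex_ball _ _)).isPreconnected
  have hmem : p₀ ∈ s := by
    rw [hs]
    exact ⟨half_lt_self hp₀, by simp⟩
  have hps : ∀ q ∈ s, p₀.1.im / 2 ≤ q.1.im ∧ ‖q.2‖ ≤ ‖p₀.2‖ + 1 := fun q hq => by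
    rw [hs] at hq
    exact ⟨le_of_lt hq.1, le_of_lt (by simpa using hq.2)⟩
  refine ⟨M, ?_⟩
  filter_upwards [hso.mem_nhds hmem] with p hp
  have hp1 : 0 < p.1.im := hη.trans_le (hps p hp).1
  have hd : ∀ n, ∀ q ∈ s, HasFDerivAt (lambertTerm a b σ (n + M))
      (linForm (2 * Real.pi * Complex.I * lambertTerm (a + 1) (b + 1) σ (n + M) q)
        (2 * Real.pi * Complex.I * σ * lambertTerm a (b + 1) σ (n + M) q)) q := fun n q hq =>
    hasFDerivAt_lambertTerm a b σ (n + M)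
      (h₁ (n + M) (by lia) σ q hσ (hps q hq).1 (hps q hq).2).1
  have hpi : ‖(2 * Real.pi * Complex.I : ℂ)‖ = 2 * Real.pi := by simp [Real.pi_pos.le]
  have hb : ∀ n, ∀ q ∈ s,
      ‖linForm (2 * Real.pi * Complex.I * lambertTerm (a + 1) (b + 1) σ (n + M) q)
        (2 * Real.pi * Complex.I * σ * lambertTerm a (b + 1) σ (n + M) q)‖ ≤
        2 * Real.pi * v₁ (n + M) + 2 * Real.pi * v₂ (n + M) := fun n q hq => by
    refine (norm_linForm_le _ _).trans ?_
    have e1 := (h₁ (n + M) (by lia) σ q hσ (hps q hq).1 (hps q hq).2).2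
    have e2 := (h₂ (n + M) (by lia) σ q hσ (hps q hq).1 (hps q hq).2).2
    rw [norm_mul (2 * Real.pi * Complex.I : ℂ), norm_mul (2 * Real.pi * Complex.I * σ),
      norm_mul (2 * Real.pi * Complex.I : ℂ) σ, hpi]
    have e3 : 2 * Real.pi * ‖σ‖ ≤ 2 * Real.pi :=
      mul_le_of_le_one_right (by positivity) hσ
    exact add_le_add (mul_le_mul_of_nonneg_left e1 (by positivity))
      (mul_le_mul e3 e2 (norm_nonneg _) (by positivity))
  have hsum := hasFDerivAt_tsum_of_isPreconnected (𝕜 := ℂ)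
    ((((summable_nat_add_iff M).2 hv₁).mul_left (2 * Real.pi)).add
      (((summable_nat_add_iff M).2 hv₂).mul_left (2 * Real.pi)))
    hso hsc hd hb hp ((summable_nat_add_iff M).2 (summable_lambertTerm a b hσ hp1)) hp
  refine hsum.congr_fderiv ?_
  rw [← tsum_mul_left, ← tsum_mul_left]
  exact (hasSum_linForm
    (((summable_nat_add_iff M).2 (summable_lambertTerm (a + 1) (b + 1) hσ hp1)).mul_left _).hasSum
    (((summable_nat_add_iff M).2 (summable_lambertTerm a (b + 1) hσ hp1)).mul_left _).hasSum
    ).tsum_eq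

lemma tsum_lambertTerm_eq (a b : ℕ) {σ : ℂ} (hσ : ‖σ‖ ≤ 1) (M : ℕ) {p : ℂ × ℂ}
    (hp : 0 < p.1.im) :
    ∑' n, lambertTerm a b σ n p =
      ∑ n ∈ Finset.range M, lambertTerm a b σ n p + ∑' n, lambertTerm a b σ (n + M) p :=
  ((summable_lambertTerm a b hσ hp).sum_add_tsum_nat_add M).symm

lemma hasFDerivAt_tsum_lambertTerm (a b : ℕ) {σ : ℂ} (hσ : ‖σ‖ ≤ 1) {p : ℂ × ℂ}
    (hp : 0 < p.1.im) (hne : ∀ n : ℕ, e (σ * p.2 + ((n : ℂ) + 1) * p.1) ≠ 1) :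
    HasFDerivAt (fun p => ∑' n, lambertTerm a b σ n p)
      (linForm (2 * Real.pi * Complex.I * ∑' n, lambertTerm (a + 1) (b + 1) σ n p)
        (2 * Real.pi * Complex.I * σ * ∑' n, lambertTerm a (b + 1) σ n p)) p := by
  obtain ⟨M, hM⟩ := exists_hasFDerivAt_lambertTail a b hσ hp
  have h1 := HasFDerivAt.fun_sum (u := Finset.range M) fun n _ =>
    hasFDerivAt_lambertTerm a b σ n (hne n)
  have h2 := h1.add hM.self_of_nhds
  have hU : ∀ᶠ q : ℂ × ℂ in 𝓝 p, 0 < q.1.im :=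
    (isOpen_lt continuous_const (Complex.continuous_im.comp continuous_fst)).mem_nhds hp
  refine (h2.congr_of_eventuallyEq ?_).congr_fderiv ?_
  · filter_upwards [hU] with q hq
    exact tsum_lambertTerm_eq a b hσ M hq
  · rw [tsum_lambertTerm_eq _ _ hσ M hp, tsum_lambertTerm_eq _ _ hσ M hp]
    ext <;> simp [mul_add, Finset.mul_sum]

/-! ### Singularity of the series `lambertSeries` -/

lemma hasDerivAt_fst_of_linForm {F : ℂ × ℂ → ℂ} {x y t z : ℂ}
    (h : HasFDerivAt F (linForm x y) (t, z)) : HasDerivAt (fun s => F (s, z)) x t := by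
  have := h.comp_hasDerivAt t ((hasDerivAt_id t).prodMk (hasDerivAt_const t z))
  simpa using! this

lemma hasDerivAt_snd_of_linForm {F : ℂ × ℂ → ℂ} {x y t z : ℂ}
    (h : HasFDerivAt F (linForm x y) (t, z)) : HasDerivAt (fun w => F (t, w)) y z := by
  have := h.comp_hasDerivAt z ((hasDerivAt_const z t).prodMk (hasDerivAt_id z))
  simpa using! this

lemma psi_e_add_eq_inv_pow_mul (b : ℕ) {σ : ℂ} (hσ : σ = 1 ∨ σ = -1) (c w : ℂ) :
    ∃ u : ℂ → ℂ, AnalyticAt ℂ u w ∧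
      ∀ᶠ z in 𝓝[≠] w, psi b (e (σ * z + c)) = ((z - w) ^ (b + 1))⁻¹ * u z := by
  have hσσ : σ * σ = 1 := by rcases hσ with rfl | rfl <;> norm_num
  have hσ0 : σ ≠ 0 := by rintro rfl; norm_num at hσσ
  by_cases hw : e (σ * w + c) = 1
  · obtain ⟨u, hu, h⟩ := exists_psi_e_eq_inv_pow_mul b
    have hmap : Tendsto (fun z => σ * (z - w)) (𝓝[≠] w) (𝓝[≠] 0) := by
      refine tendsto_nhdsWithin_of_tendsto_nhds_of_eventually_within _ ?_ ?_
      · have : Tendsto (fun z => σ * (z - w)) (𝓝 w) (𝓝 (σ * (w - w))) :=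
          Continuous.tendsto (by fun_prop) _
        rw [sub_self, mul_zero] at this
        exact this.mono_left nhdsWithin_le_nhds
      · filter_upwards [self_mem_nhdsWithin] with z hz
        exact mul_ne_zero hσ0 (sub_ne_zero.2 hz)
    refine ⟨fun z => σ ^ (b + 1) * u (σ * (z - w)), ?_, ?_⟩
    · refine analyticAt_const.mul (AnalyticAt.fun_comp ?_ (by fun_prop))
      simpa using hu
    · filter_upwards [hmap.eventually h] with z hz
      have he : e (σ * z + c) = e (σ * (z - w)) := by
        rw [show σ * z + c = σ * (z - w) + (σ * w + c) by ring, e_add, hw, mul_one]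
      -- For `σ = ±1` the factor `σ ^ (b + 1)` is its own inverse, which absorbs the inverse power
      -- produced by rescaling the pole.
      have hp : σ ^ (b + 1) * σ ^ (b + 1) = 1 := by rw [← mul_pow, hσσ, one_pow]
      rw [he, hz, sub_zero, mul_pow, mul_inv, ← eq_inv_of_mul_eq_one_left hp]
      ring
  · have hean : AnalyticAt ℂ e (σ * w + c) :=
      (show Differentiable ℂ e from fun w => (hasDerivAt_e w).differentiableAt).analyticAt _
    have : AnalyticAt ℂ (fun z => psi b (e (σ * z + c))) w :=
      AnalyticAt.fun_comp (f := fun z => e (σ * z + c)) (analyticAt_psi b hw)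
        (AnalyticAt.fun_comp (f := fun z => σ * z + c) (analyticAt_e _) (by fun_prop))
    refine ⟨fun z => (z - w) ^ (b + 1) * psi b (e (σ * z + c)), by fun_prop, ?_⟩
    filter_upwards [self_mem_nhdsWithin] with z hz
    rw [inv_mul_cancel_left₀ (pow_ne_zero _ (sub_ne_zero.2 hz))]

lemma norm_le_one_of_eq {σ : ℂ} (hσ : σ = 1 ∨ σ = -1) : ‖σ‖ ≤ 1 := by
  rcases hσ with rfl | rfl <;> simp

lemma e_ne_one_of_notMem_lattice {σ : ℂ} (hσ : σ = 1 ∨ σ = -1) {τ : ℍ} {z : ℂ}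
    (hz : z ∉ lattice τ) (n : ℕ) : e (σ * z + ((n : ℂ) + 1) * (τ : ℂ)) ≠ 1 := by
  intro h
  obtain ⟨m, hm⟩ := e_eq_one_iff.1 h
  have : σ * z ∈ lattice τ := ⟨m, -(n + 1), by push_cast; linear_combination hm⟩
  rcases hσ with rfl | rfl
  · exact hz (by simpa using this)
  · exact hz (neg_mem_lattice_iff.1 (by simpa using this))

/-- The series starts at `n = 1`, so its poles lie on the lines `Im z = ± n Im τ` and avoid this
strip around `0`. Hence the series is analytic at `z = 0`, although `0` is a lattice point. -/
lemma e_ne_one_of_abs_im_lt {σ : ℂ} (hσ : σ = 1 ∨ σ = -1) {τ : ℍ} {z : ℂ}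
    (hz : |z.im| < τ.im) (n : ℕ) : e (σ * z + ((n : ℂ) + 1) * (τ : ℂ)) ≠ 1 := by
  intro h
  obtain ⟨m, hm⟩ := e_eq_one_iff.1 h
  have him := congrArg Complex.im hm
  have h1 : |(σ * z).im| < τ.im := by rcases hσ with rfl | rfl <;> simpa using hz
  simp only [Complex.add_im, Complex.intCast_im] at him
  have h2 : (((n : ℂ) + 1) * (τ : ℂ)).im = (n + 1) * τ.im := by simp [Complex.mul_im]
  rw [h2] at him
  have h3 := (abs_lt.1 h1).1
  have h4 : 0 ≤ (n : ℝ) * τ.im := by have := τ.im_pos; positivity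
  linarith

lemma hasFDerivAt_lambertSeries (a b : ℕ) {σ : ℂ} (hσ : σ = 1 ∨ σ = -1) {τ : ℍ} {z : ℂ}
    (hne : ∀ n : ℕ, e (σ * z + ((n : ℂ) + 1) * (τ : ℂ)) ≠ 1) :
    HasFDerivAt (fun p : ℂ × ℂ => lambertSeries a b σ (UpperHalfPlane.ofComplex p.1) p.2)
      (linForm (2 * Real.pi * Complex.I * lambertSeries (a + 1) (b + 1) σ τ z)
        (2 * Real.pi * Complex.I * σ * lambertSeries a (b + 1) σ τ z)) ((τ : ℂ), z) := by
  refine (hasFDerivAt_tsum_lambertTerm a b (norm_le_one_of_eq hσ) (p := ((τ : ℂ), z))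
    τ.im_pos hne).congr_of_eventuallyEq ?_
  filter_upwards [(continuous_fst.tendsto ((τ : ℂ), z)).eventually (eventually_ofComplex τ)]
    with p hp
  simp only [lambertSeries, hp]

lemma hasDerivAt_lambertSeries (a b : ℕ) {σ : ℂ} (hσ : σ = 1 ∨ σ = -1) {τ : ℍ} {z : ℂ}
    (hne : ∀ n : ℕ, e (σ * z + ((n : ℂ) + 1) * (τ : ℂ)) ≠ 1) :
    HasDerivAt (lambertSeries a b σ τ)
      (2 * Real.pi * Complex.I * σ * lambertSeries a (b + 1) σ τ z) z := by
  simpa [UpperHalfPlane.ofComplex_apply] using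
    hasDerivAt_snd_of_linForm (hasFDerivAt_lambertSeries a b hσ hne)

lemma isOpen_abs_im_lt (τ : ℍ) : IsOpen {z : ℂ | |z.im| < τ.im} :=
  isOpen_lt (by fun_prop) continuous_const

lemma iteratedDeriv_lambertSeries (a b : ℕ) {σ : ℂ} (hσ : σ = 1 ∨ σ = -1) (τ : ℍ) (j : ℕ) :
    ∀ z : ℂ, |z.im| < τ.im → iteratedDeriv j (lambertSeries a b σ τ) z =
      (2 * Real.pi * Complex.I * σ) ^ j * lambertSeries a (b + j) σ τ z := by
  induction j with
  | zero => intro z _; simp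
  | succ j ih =>
    intro z hz
    have h : iteratedDeriv j (lambertSeries a b σ τ) =ᶠ[𝓝 z]
        fun z => (2 * Real.pi * Complex.I * σ) ^ j * lambertSeries a (b + j) σ τ z := by
      filter_upwards [(isOpen_abs_im_lt τ).mem_nhds hz] with w hw using ih w hw
    rw [iteratedDeriv_succ, h.deriv_eq,
      ((hasDerivAt_lambertSeries a (b + j) hσ (e_ne_one_of_abs_im_lt hσ hz)).const_mul _).deriv]
    rw [← add_assoc]; ring

/-- At `z = 0` the series depends only on `q` and converges locally uniformly on the unit disc. By
`iteratedDeriv_lambertSeries` these values give all Taylor coefficients at `0`. -/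
lemma holomorphicAtInfinity_lambertSeries_zero (a b : ℕ) (σ : ℂ) :
    HolomorphicAtInfinity fun τ => lambertSeries a b σ τ 0 := by
  refine holomorphicAtInfinity_iff.2
    ⟨fun q => ∑' n : ℕ, ((n : ℂ) + 1) ^ a * psi b (q ^ (n + 1)), ?_, fun τ => ?_⟩
  · have key : ∀ r : ℝ, 0 ≤ r → r < 1 → DifferentiableOn ℂ
        (fun q : ℂ => ∑' n : ℕ, ((n : ℂ) + 1) ^ a * psi b (q ^ (n + 1))) (Metric.ball 0 r) := by
      intro r hr0 hr1
      obtain ⟨C, hC0, hC⟩ := exists_norm_psi_le b hr1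
      have hpow : ∀ (q : ℂ) (n : ℕ), q ∈ Metric.ball (0 : ℂ) r → ‖q ^ (n + 1)‖ ≤ r ∧
          ‖q ^ (n + 1)‖ ≤ r ^ (n + 1) := by
        intro q n hq
        have hq : ‖q‖ < r := by simpa using hq
        rw [norm_pow]
        have h1 : ‖q‖ ^ (n + 1) ≤ r ^ (n + 1) := pow_le_pow_left₀ (norm_nonneg _) hq.le _
        exact ⟨h1.trans (pow_le_of_le_one hr0 hr1.le (Nat.succ_ne_zero n)), h1⟩
      refine differentiableOn_tsum_of_summable_norm
        (u := fun n => ((n : ℝ) + 1) ^ a * (C * r ^ (n + 1))) ?_ ?_ Metric.isOpen_ball ?_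
      · have h := summable_pow_mul_geometric_of_norm_lt_one a (r := r)
          (by rwa [Real.norm_of_nonneg hr0])
        refine (((summable_nat_add_iff 1).2 h).mul_left C).congr fun n => ?_
        push_cast; ring
      · intro n q hq
        have h1 : q ^ (n + 1) ≠ 1 := fun h => by
          have := (hpow q n hq).1
          rw [h, norm_one] at this
          linarith
        have := (analyticAt_psi b h1).differentiableAt
        refine DifferentiableAt.differentiableWithinAt ?_
        exact (this.comp q (f := fun q : ℂ => q ^ (n + 1)) (by fun_prop)).const_mul _
      · intro n q hq
        have hn1 : ‖(n : ℂ) + 1‖ = (n : ℝ) + 1 := by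
          have : ((n : ℂ) + 1) = ((n + 1 : ℕ) : ℂ) := by push_cast; ring
          rw [this, Complex.norm_natCast]; push_cast; ring
        rw [norm_mul, norm_pow, hn1]
        exact mul_le_mul_of_nonneg_left ((hC _ (hpow q n hq).1).trans
          (mul_le_mul_of_nonneg_left (hpow q n hq).2 hC0)) (by positivity)
    intro q hq
    have hq : ‖q‖ < 1 := by simpa using hq
    obtain ⟨r, hr, hr1⟩ := exists_between hq
    have hmem : Metric.ball (0 : ℂ) r ∈ 𝓝 q :=
      Metric.isOpen_ball.mem_nhds (by simpa using hr)
    exact ((key r ((norm_nonneg q).trans hr.le) hr1).differentiableAt hmem).differentiableWithinAt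
  · refine tsum_congr fun n => ?_
    have : e (((n : ℂ) + 1) * (τ : ℂ)) = e τ ^ (n + 1) := by
      rw [← e_natCast_mul]; push_cast; rfl
    simp [lambertTerm, this]

lemma taylorHolomorphic_lambertSeries (a b : ℕ) {σ : ℂ} (hσ : σ = 1 ∨ σ = -1) :
    TaylorHolomorphic (lambertSeries a b σ) := by
  refine ⟨fun τ => ?_, fun n => ?_⟩
  · rw [Complex.analyticAt_iff_eventually_differentiableAt]
    filter_upwards [(isOpen_abs_im_lt τ).mem_nhds (by simpa using τ.im_pos)] with z hz
    exact (hasDerivAt_lambertSeries a b hσ (e_ne_one_of_abs_im_lt hσ hz)).differentiableAt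
  · have : ∀ τ : ℍ, iteratedDeriv n (lambertSeries a b σ τ) 0 =
        (2 * Real.pi * Complex.I * σ) ^ n * lambertSeries a (b + n) σ τ 0 := fun τ =>
      iteratedDeriv_lambertSeries a b hσ τ n 0 (by simpa using τ.im_pos)
    simp only [this]
    exact (HolomorphicAtInfinity.const _).mul (holomorphicAtInfinity_lambertSeries_zero _ _ _)

/-- Near a lattice point only finitely many terms can have a pole, each of order at most `b + 1`,
and the tail is analytic. Periodicity in `z` and in `τ` holds term by term because `e` has period
`1`. -/
lemma isSingular_lambertSeries (a b : ℕ) {σ : ℂ} (hσ : σ = 1 ∨ σ = -1) :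
    IsSingular (lambertSeries a b σ) := by
  have hσ1 := norm_le_one_of_eq hσ
  have heσ : e σ = 1 := by
    rcases hσ with rfl | rfl
    · exact_mod_cast e_intCast 1
    · exact_mod_cast e_intCast (-1)
  refine IsSingular.of_taylor (fun τ z hz => ?_) ⟨b + 1, fun τ w _ => ?_⟩ (fun τ z hz => ?_)
    (fun τ z hz => ?_) ⟨0, _, taylorHolomorphic_lambertSeries a b hσ, fun τ => by simp⟩
  · rw [Complex.analyticAt_iff_eventually_differentiableAt]
    filter_upwards [eventually_notMem_lattice_of_notMem hz] with w hw
    exact (hasDerivAt_lambertSeries a b hσ (e_ne_one_of_notMem_lattice hσ hw)).differentiableAt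
  · obtain ⟨M, hM⟩ := exists_hasFDerivAt_lambertTail a b hσ1 (p₀ := ((τ : ℂ), w)) τ.im_pos
    have htail : AnalyticAt ℂ (fun z => ∑' n, lambertTerm a b σ (n + M) ((τ : ℂ), z)) w := by
      rw [Complex.analyticAt_iff_eventually_differentiableAt]
      have : Tendsto (fun z : ℂ => ((τ : ℂ), z)) (𝓝 w) (𝓝 ((τ : ℂ), w)) :=
        Continuous.tendsto (by fun_prop) _
      filter_upwards [this.eventually hM] with z hz
      exact (hasDerivAt_snd_of_linForm hz).differentiableAt
    choose u hu h using fun n : ℕ =>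
      psi_e_add_eq_inv_pow_mul b hσ (((n : ℂ) + 1) * (τ : ℂ)) w
    refine neg_le_meromorphicOrderAt_of_analyticAt
      (u := fun z => ∑ n ∈ Finset.range M, ((n : ℂ) + 1) ^ a * u n z +
        (z - w) ^ (b + 1) * ∑' n, lambertTerm a b σ (n + M) ((τ : ℂ), z)) ?_ ?_
    · refine AnalyticAt.add ?_ (AnalyticAt.mul (by fun_prop) htail)
      exact Finset.analyticAt_fun_sum _ fun n _ => analyticAt_const.mul (hu n)
    · filter_upwards [(Finset.range M).eventually_all.2 fun n _ => h n, self_mem_nhdsWithin]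
        with z hz h0
      have h0 : (z - w) ^ (b + 1) ≠ 0 := pow_ne_zero _ (sub_ne_zero.2 h0)
      rw [lambertSeries, tsum_lambertTerm_eq a b hσ1 M (p := ((τ : ℂ), z)) τ.im_pos, mul_add,
        inv_mul_cancel_left₀ h0, Finset.mul_sum]
      congr 1
      refine Finset.sum_congr rfl fun n hn => ?_
      rw [lambertTerm, hz n hn]; ring
  · refine tsum_congr fun n => ?_
    simp only [lambertTerm]
    rw [show σ * (z + 1) + ((n : ℂ) + 1) * (τ : ℂ) = σ * z + ((n : ℂ) + 1) * (τ : ℂ) + σ by ring,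
      e_add _ σ, heσ, mul_one]
  · refine tsum_congr fun n => ?_
    simp only [lambertTerm, UpperHalfPlane.coe_vadd]
    rw [show σ * z + ((n : ℂ) + 1) * (((1 : ℝ) : ℂ) + (τ : ℂ)) =
      σ * z + ((n : ℂ) + 1) * (τ : ℂ) + ((n + 1 : ℤ) : ℂ) by push_cast; ring, e_add _ (_ : ℂ),
      e_intCast, mul_one]

lemma e_ne_one_of_notMem {τ : ℍ} {z : ℂ} (hz : z ∉ lattice τ) : e z ≠ 1 := fun h => by
  obtain ⟨m, rfl⟩ := e_eq_one_iff.1 h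
  exact hz ⟨m, 0, by simp⟩

lemma isSingular_psi_e (b : ℕ) : IsSingular fun _ z => psi b (e z) := by
  have hpole : ∀ w : ℂ, ∃ u : ℂ → ℂ, AnalyticAt ℂ u w ∧
      ∀ᶠ z in 𝓝[≠] w, psi b (e z) = ((z - w) ^ (b + 1))⁻¹ * u z := fun w => by
    simpa using psi_e_add_eq_inv_pow_mul b (Or.inl rfl) 0 w
  refine IsSingular.of_taylor (fun τ z hz => ?_) ⟨b + 1, fun τ w _ => ?_⟩ (fun τ z hz => ?_)
    (fun τ z hz => rfl) ?_
  · exact (analyticAt_psi b (e_ne_one_of_notMem hz)).fun_comp (analyticAt_e z)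
  · obtain ⟨u, hu, h⟩ := hpole w
    exact neg_le_meromorphicOrderAt_of_analyticAt hu h
  · have : e (1 : ℂ) = 1 := by exact_mod_cast e_intCast 1
    simp only [e_add, this, mul_one]
  · obtain ⟨u, hu, h⟩ := hpole 0
    exact ⟨b + 1, fun _ => u, TaylorHolomorphic.of_const hu, fun _ => by simpa using h⟩

/-! ### Singular functions with singular partial derivatives -/

/-- Singular functions that are differentiable in both variables, with a singular partial
derivative in `τ`. -/
def HasSingularPartials (f : ℍ → ℂ → ℂ) : Prop :=
  IsSingular f ∧ ∃ ft : ℍ → ℂ → ℂ, IsSingular ft ∧ ∀ (τ : ℍ) (z : ℂ), z ∉ lattice τ →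
    HasFDerivAt (fun p : ℂ × ℂ => f (UpperHalfPlane.ofComplex p.1) p.2)
      (linForm (ft τ z) (dZ f τ z)) ((τ : ℂ), z)

namespace HasSingularPartials

lemma of_hasFDerivAt {f ft fz : ℍ → ℂ → ℂ} (hf : IsSingular f) (hft : IsSingular ft)
    (h : ∀ (τ : ℍ) (z : ℂ), z ∉ lattice τ →
      HasFDerivAt (fun p : ℂ × ℂ => f (UpperHalfPlane.ofComplex p.1) p.2)
        (linForm (ft τ z) (fz τ z)) ((τ : ℂ), z)) : HasSingularPartials f := by
  refine ⟨hf, ft, hft, fun τ z hz => ?_⟩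
  have h1 := hasDerivAt_snd_of_linForm (h τ z hz)
  simp only [UpperHalfPlane.ofComplex_apply] at h1
  have h2 : dZ f τ z = fz τ z := h1.deriv
  rw [h2]
  exact h τ z hz

lemma congr {f g : ℍ → ℂ → ℂ} (hf : HasSingularPartials f)
    (h : ∀ (τ : ℍ) (z : ℂ), z ∉ lattice τ → g τ z = f τ z) : HasSingularPartials g := by
  obtain ⟨hs, ft, hft, hd⟩ := hf
  refine of_hasFDerivAt (hs.congr h) hft fun τ z hz =>
    (hd τ z hz).congr_of_eventuallyEq ?_
  filter_upwards [isOpen_offLattice.mem_nhds (coe_mem_offLattice.2 hz)] with p hp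
  exact h _ _ hp.2

lemma add {f g : ℍ → ℂ → ℂ} (hf : HasSingularPartials f) (hg : HasSingularPartials g) :
    HasSingularPartials fun τ z => f τ z + g τ z := by
  obtain ⟨hs, ft, hft, hd⟩ := hf
  obtain ⟨hs', gt, hgt, hd'⟩ := hg
  refine of_hasFDerivAt (fz := fun τ z => dZ f τ z + dZ g τ z) (hs.add hs') (hft.add hgt)
    fun τ z hz => ((hd τ z hz).add (hd' τ z hz)).congr_fderiv ?_
  ext <;> simp

lemma mul {f g : ℍ → ℂ → ℂ} (hf : HasSingularPartials f) (hg : HasSingularPartials g) :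
    HasSingularPartials fun τ z => f τ z * g τ z := by
  obtain ⟨hs, ft, hft, hd⟩ := hf
  obtain ⟨hs', gt, hgt, hd'⟩ := hg
  refine of_hasFDerivAt (ft := fun τ z => f τ z * gt τ z + g τ z * ft τ z)
    (fz := fun τ z => f τ z * dZ g τ z + g τ z * dZ f τ z) (hs.mul hs')
    ((hs.mul hgt).add (hs'.mul hft))
    fun τ z hz => ((hd τ z hz).mul (hd' τ z hz)).congr_fderiv ?_
  ext <;> simp [UpperHalfPlane.ofComplex_apply]

lemma of_holomorphicAtInfinity {A : ℍ → ℂ} (hA : HolomorphicAtInfinity A) :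
    HasSingularPartials fun τ _ => A τ := by
  obtain ⟨B, hB, hd⟩ := hA.exists_hasDerivAt
  refine of_hasFDerivAt (fz := fun _ _ => 0) (IsSingular.of_holomorphicAtInfinity hA)
    (IsSingular.of_holomorphicAtInfinity hB) fun τ z _ => ?_
  have hfst : HasFDerivAt (fun p : ℂ × ℂ => p.1) (ContinuousLinearMap.fst ℂ ℂ ℂ) ((τ : ℂ), z) :=
    hasFDerivAt_fst
  have h := HasDerivAt.comp_hasFDerivAt ((τ : ℂ), z) (hd τ) hfst
  refine h.congr_fderiv ?_
  ext <;> simp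

lemma const (c : ℂ) : HasSingularPartials fun _ _ => c :=
  of_holomorphicAtInfinity (HolomorphicAtInfinity.const c)

lemma const_mul {f : ℍ → ℂ → ℂ} (c : ℂ) (hf : HasSingularPartials f) :
    HasSingularPartials fun τ z => c * f τ z :=
  (const c).mul hf

lemma pow {f : ℍ → ℂ → ℂ} (hf : HasSingularPartials f) (n : ℕ) :
    HasSingularPartials fun τ z => f τ z ^ n := by
  induction n with
  | zero => simpa using const 1
  | succ n ih => simpa [pow_succ] using ih.mul hf

lemma sum {ι : Type*} (s : Finset ι) {f : ι → ℍ → ℂ → ℂ}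
    (hf : ∀ i ∈ s, HasSingularPartials (f i)) :
    HasSingularPartials fun τ z => ∑ i ∈ s, f i τ z := by
  classical
  induction s using Finset.induction_on with
  | empty => simpa using const 0
  | insert a s ha ih =>
    simp only [Finset.sum_insert ha]
    exact (hf a (Finset.mem_insert_self _ _)).add
      (ih fun i hi => hf i (Finset.mem_insert_of_mem hi))

lemma lambertSeries (a b : ℕ) {σ : ℂ} (hσ : σ = 1 ∨ σ = -1) :
    HasSingularPartials (lambertSeries a b σ) :=
  of_hasFDerivAt (isSingular_lambertSeries a b hσ)
    (fz := fun τ z => 2 * Real.pi * Complex.I * σ * QuasiJacobi.lambertSeries a (b + 1) σ τ z)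
    ((isSingular_lambertSeries (a + 1) (b + 1) hσ).const_mul (2 * Real.pi * Complex.I))
    fun _ _ hz => hasFDerivAt_lambertSeries a b hσ (e_ne_one_of_notMem_lattice hσ hz)

lemma psi_e (b : ℕ) : HasSingularPartials fun _ z => psi b (e z) := by
  refine of_hasFDerivAt (ft := fun _ _ => 0)
    (fz := fun _ z => 2 * Real.pi * Complex.I * psi (b + 1) (e z)) (isSingular_psi_e b)
    (IsSingular.const 0) fun τ z hz => ?_
  have hsnd : HasFDerivAt (fun p : ℂ × ℂ => p.2) (ContinuousLinearMap.snd ℂ ℂ ℂ) ((τ : ℂ), z) :=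
    hasFDerivAt_snd
  have h := HasDerivAt.comp_hasFDerivAt ((τ : ℂ), z)
    (hasDerivAt_psi_e b (e_ne_one_of_notMem hz)) hsnd
  refine h.congr_fderiv ?_
  ext <;> simp

lemma hasPartials {f : ℍ → ℂ → ℂ} (hf : HasSingularPartials f) : HasPartials f := by
  obtain ⟨hs, ft, -, hd⟩ := hf
  exact fun τ z hz => ⟨(hasDerivAt_fst_of_linForm (hd τ z hz)).differentiableAt,
    (hs.analyticAt τ z hz).differentiableAt⟩

lemma hasFDerivAt {f : ℍ → ℂ → ℂ} (hf : HasSingularPartials f) {τ : ℍ} {z : ℂ}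
    (hz : z ∉ lattice τ) :
    HasFDerivAt (fun p : ℂ × ℂ => f (UpperHalfPlane.ofComplex p.1) p.2)
      (linForm (deriv (tauSlice f z) τ) (dZ f τ z)) ((τ : ℂ), z) := by
  obtain ⟨-, ft, -, hd⟩ := hf
  have h : deriv (tauSlice f z) τ = ft τ z := (hasDerivAt_fst_of_linForm (hd τ z hz)).deriv
  rw [h]
  exact hd τ z hz

lemma isSingular_dTau {f : ℍ → ℂ → ℂ} (hf : HasSingularPartials f) : IsSingular (dTau f) := by
  obtain ⟨-, ft, hft, hd⟩ := hf
  refine (hft.const_mul ((Real.pi : ℂ) / (2 * Complex.I))).congr fun τ z hz => ?_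
  rw [dTau, show deriv (tauSlice f z) τ = ft τ z from
    (hasDerivAt_fst_of_linForm (hd τ z hz)).deriv]

end HasSingularPartials

/-! ### The derivatives of `E₁` -/

/-- The `b`-th derivative in `z` of the function `E₁`, as a series. -/
def E1Deriv (b : ℕ) (τ : ℍ) (z : ℂ) : ℂ :=
  (if b = 0 then -(Real.pi * Complex.I) else 0) -
    (2 * Real.pi * Complex.I) ^ (b + 1) * (psi b (e z) + (lambertSeries 0 b 1 τ z +
      (-1) ^ (b + 1) * lambertSeries 0 b (-1) τ z))

lemma hasSingularPartials_E1Deriv (b : ℕ) : HasSingularPartials (E1Deriv b) := by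
  have h := (HasSingularPartials.psi_e b).add ((HasSingularPartials.lambertSeries 0 b
    (Or.inl rfl)).add ((HasSingularPartials.lambertSeries 0 b (Or.inr rfl)).const_mul
      ((-1) ^ (b + 1))))
  refine ((HasSingularPartials.const (if b = 0 then -(Real.pi * Complex.I) else 0)).add
    (h.const_mul (-(2 * Real.pi * Complex.I) ^ (b + 1)))).congr fun τ z _ => ?_
  rw [E1Deriv]; ring

lemma hasDerivAt_E1Deriv (b : ℕ) {τ : ℍ} {z : ℂ} (hz : z ∉ lattice τ) :
    HasDerivAt (E1Deriv b τ) (E1Deriv (b + 1) τ z) z := by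
  have h1 := hasDerivAt_psi_e b (e_ne_one_of_notMem hz)
  have h2 := hasDerivAt_lambertSeries 0 b (Or.inl rfl)
    (e_ne_one_of_notMem_lattice (Or.inl rfl) hz)
  have h3 := (hasDerivAt_lambertSeries 0 b (Or.inr rfl)
    (e_ne_one_of_notMem_lattice (Or.inr rfl) hz)).const_mul ((-1) ^ (b + 1))
  refine (((h1.add (h2.add h3)).const_mul ((2 * Real.pi * Complex.I) ^ (b + 1))).const_sub
    (if b = 0 then -(Real.pi * Complex.I) else 0)).congr_deriv ?_
  rw [E1Deriv, if_neg (Nat.succ_ne_zero b)]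
  ring

/-! ### Evaluation of `E₁` -/

lemma sum_Icc_neg_eq {M : Type*} [AddCommMonoid M] (f : ℤ → M) (N : ℕ) :
    ∑ n ∈ Finset.Icc (-(N : ℤ)) N, f n =
      f 0 + ∑ j ∈ Finset.range N, (f (j + 1) + f (-(j + 1))) := by
  induction N with
  | zero => simp
  | succ N ih =>
    have h : Finset.Icc (-((N + 1 : ℕ) : ℤ)) ((N + 1 : ℕ) : ℤ) =
        insert ((N : ℤ) + 1) (insert (-((N : ℤ) + 1)) (Finset.Icc (-(N : ℤ)) N)) := by
      ext m; simp; lia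
    rw [h, Finset.sum_insert (by simp; lia), Finset.sum_insert (by simp), ih,
      Finset.sum_range_succ]
    abel

/-- The function `π cot(πw)`, as a function of `exp(2πiw)`. -/
def piCot (w : ℂ) : ℂ := -(Real.pi * Complex.I) - 2 * Real.pi * Complex.I * psi 0 (e w)

lemma piCot_eq {w : ℂ} (hw : e w ≠ 1) : piCot w = Real.pi * Complex.cot (Real.pi * w) := by
  have h : 1 - e w ≠ 0 := sub_ne_zero.2 hw.symm
  rw [Complex.cot_pi_eq_exp_ratio, piCot, psi]
  change _ = (Real.pi : ℂ) * ((e w + 1) / (Complex.I * (1 - e w)))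
  have hI := Complex.I_ne_zero
  field_simp
  rw [Complex.I_sq]
  ring

lemma piCot_neg {w : ℂ} (hw : e w ≠ 1) : piCot (-w) = -piCot w := by
  have h : 1 - e w ≠ 0 := sub_ne_zero.2 hw.symm
  have h' : e w - 1 ≠ 0 := sub_ne_zero.2 hw
  have h0 := e_ne_zero w
  have h2 : 1 - (e w)⁻¹ = (e w - 1) / e w := by field_simp
  simp only [piCot, psi, e_neg, h2]
  have h3 : (1 - e w) = -(e w - 1) := by ring
  rw [h3]
  field_simp
  ring

/-- This is the Mittag-Leffler expansion of the cotangent, with the terms for `m` and `-m` paired by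
the symmetric summation. -/
lemma hasSum_one_div_add {w : ℂ} (hw : e w ≠ 1) :
    HasSum (fun m : ℤ => 1 / (w + (m : ℂ))) (piCot w) (SummationFilter.symmetricIcc ℤ) := by
  have hw' : w ∈ Complex.integerComplement := fun ⟨n, hn⟩ => hw (e_eq_one_iff.2 ⟨n, hn.symm⟩)
  rw [SummationFilter.hasSum_symmetricIcc_iff]
  have h := (tendsto_logDeriv_euler_cot_sub hw').const_add (1 / w)
  rw [add_sub_cancel, ← piCot_eq hw] at h
  refine h.congr fun N => ?_
  rw [sum_Icc_neg_eq]
  congr 1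
  · simp
  · refine Finset.sum_congr rfl fun j _ => ?_
    simp only [cotTerm]
    push_cast
    rw [add_comm, sub_eq_add_neg]

lemma e_add_int_mul_ne_one {τ : ℍ} {z : ℂ} (hz : z ∉ lattice τ) (n : ℤ) :
    e (z + (n : ℂ) * (τ : ℂ)) ≠ 1 :=
  e_ne_one_of_notMem (τ := τ) (by rwa [add_mem_lattice_iff ⟨0, n, by simp⟩])

lemma neg_notMem {τ : ℍ} {z : ℂ} (hz : z ∉ lattice τ) : -z ∉ lattice τ := by
  rwa [neg_mem_lattice_iff]

/-- The function `piCot` is odd, so a term of negative index `-n` becomes `-piCot (-z + nτ)`. The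
constants `∓πi` of the terms `±n` cancel, leaving the two convergent Lambert series with `σ = 1` and
`σ = -1`. -/
lemma tendsto_sum_piCot {τ : ℍ} {z : ℂ} (hz : z ∉ lattice τ) :
    Tendsto (fun N : ℕ => ∑ n ∈ Finset.Icc (-(N : ℤ)) N, piCot (z + (n : ℂ) * (τ : ℂ))) atTop
      (𝓝 (E1Deriv 0 τ z)) := by
  have h1 := (summable_lambertTerm 0 0 (σ := 1) (by simp) (p := ((τ : ℂ), z))
    τ.im_pos).hasSum.tendsto_sum_nat
  have h2 := (summable_lambertTerm 0 0 (σ := -1) (by simp) (p := ((τ : ℂ), z))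
    τ.im_pos).hasSum.tendsto_sum_nat
  have h3 := ((h1.sub h2).const_mul (-(2 * Real.pi * Complex.I))).const_add (piCot z)
  have h4 : E1Deriv 0 τ z = piCot z + -(2 * Real.pi * Complex.I) *
      (∑' n, lambertTerm 0 0 1 n ((τ : ℂ), z) - ∑' n, lambertTerm 0 0 (-1) n ((τ : ℂ), z)) := by
    simp only [E1Deriv, piCot, lambertSeries, if_true]
    ring
  rw [h4]
  refine h3.congr fun N => ?_
  rw [sum_Icc_neg_eq, ← Finset.sum_sub_distrib, Finset.mul_sum]
  congr 1
  · simp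
  · refine Finset.sum_congr rfl fun j _ => ?_
    have h5 : z + ((-((j : ℤ) + 1) : ℤ) : ℂ) * (τ : ℂ) =
        -(-z + (((j : ℤ) + 1 : ℤ) : ℂ) * (τ : ℂ)) := by push_cast; ring
    rw [h5, piCot_neg (e_add_int_mul_ne_one (neg_notMem hz) _)]
    simp only [piCot, lambertTerm]
    push_cast
    ring_nf

lemma E1_eq {τ : ℍ} {z : ℂ} (hz : z ∉ lattice τ) : E1 τ z = E1Deriv 0 τ z := by
  have h1 : ∀ n : ℤ, ∑'[SummationFilter.symmetricIcc ℤ] m : ℤ,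
      1 / (z + (m : ℂ) + (n : ℂ) * (τ : ℂ)) = piCot (z + (n : ℂ) * (τ : ℂ)) := fun n => by
    rw [← (hasSum_one_div_add (e_add_int_mul_ne_one hz n)).tsum_eq]
    exact tsum_congr fun m => by ring_nf
  rw [E1]
  simp only [h1]
  exact (SummationFilter.hasSum_symmetricIcc_iff.2 (tendsto_sum_piCot hz)).tsum_eq

lemma E1Deriv_zero_neg {τ : ℍ} {z : ℂ} (hz : z ∉ lattice τ) :
    E1Deriv 0 τ (-z) = -E1Deriv 0 τ z := by
  have h1 : ∀ w, E1Deriv 0 τ w = piCot w - 2 * Real.pi * Complex.I *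
      (lambertSeries 0 0 1 τ w - lambertSeries 0 0 (-1) τ w) := fun w => by
    simp only [E1Deriv, piCot, if_true]
    ring
  have h2 : lambertSeries 0 0 1 τ (-z) = lambertSeries 0 0 (-1) τ z :=
    tsum_congr fun n => by simp [lambertTerm]
  have h3 : lambertSeries 0 0 (-1) τ (-z) = lambertSeries 0 0 1 τ z :=
    tsum_congr fun n => by simp [lambertTerm]
  rw [h1, h1, h2, h3, piCot_neg (e_ne_one_of_notMem hz)]
  ring

lemma tendsto_piCot_add {τ : ℍ} (z : ℂ) :
    Tendsto (fun N : ℕ => piCot (z + ((N : ℂ) + 1) * (τ : ℂ))) atTop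
      (𝓝 (-(Real.pi * Complex.I))) := by
  have h := (summable_lambertTerm 0 0 (σ := 1) (by simp) (p := ((τ : ℂ), z))
    τ.im_pos).tendsto_atTop_zero
  have := (h.const_mul (2 * Real.pi * Complex.I)).const_sub (-(Real.pi * Complex.I : ℂ))
  rw [mul_zero, sub_zero] at this
  refine this.congr fun N => ?_
  simp [piCot, lambertTerm]

/-- The symmetric partial sums at `z + τ` and `z` differ by two boundary terms. The cotangent tends
to `-πi` at one end and to `πi` at the other, which leaves `-2πi`. -/
lemma E1Deriv_zero_add_tau {τ : ℍ} {z : ℂ} (hz : z ∉ lattice τ) :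
    E1Deriv 0 τ (z + τ) = E1Deriv 0 τ z - 2 * Real.pi * Complex.I := by
  have hz' : z + τ ∉ lattice τ := by rwa [add_mem_lattice_iff (coe_mem_lattice τ)]
  have h1 := (tendsto_sum_piCot hz').sub (tendsto_sum_piCot hz)
  have htel : ∀ N : ℕ, ∑ n ∈ Finset.Icc (-(N : ℤ)) N, piCot (z + τ + (n : ℂ) * (τ : ℂ)) -
      ∑ n ∈ Finset.Icc (-(N : ℤ)) N, piCot (z + (n : ℂ) * (τ : ℂ)) =
      piCot (z + ((N : ℂ) + 1) * (τ : ℂ)) - piCot (z - (N : ℂ) * (τ : ℂ)) := fun N => by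
    simp only [sum_Icc_neg_eq]
    induction N with
    | zero => simp
    | succ N ih =>
      rw [Finset.sum_range_succ, Finset.sum_range_succ]
      push_cast at ih ⊢
      have e1 : z + τ + ((N : ℂ) + 1) * τ = z + ((N : ℂ) + 1 + 1) * τ := by ring
      have e2 : z + τ + -((N : ℂ) + 1) * τ = z - N * τ := by ring
      have e3 : z + -((N : ℂ) + 1) * τ = z - ((N : ℂ) + 1) * τ := by ring
      rw [e1, e2, e3]
      rw [sub_eq_iff_eq_add] at ih
      linear_combination ih
  simp only [htel] at h1
  -- The shift of `N` turns the lower boundary term into `piCot (z - (N + 1)τ)`, to which oddness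
  -- and `tendsto_piCot_add` apply.
  rw [← tendsto_add_atTop_iff_nat 1] at h1
  have h2 : Tendsto (fun N : ℕ => piCot (z - ((N + 1 : ℕ) : ℂ) * (τ : ℂ))) atTop
      (𝓝 (-(-(Real.pi * Complex.I)))) := by
    refine (tendsto_piCot_add (τ := τ) (-z)).neg.congr fun N => ?_
    have h5 : z - ((N + 1 : ℕ) : ℂ) * (τ : ℂ) =
        -(-z + (((N : ℤ) + 1 : ℤ) : ℂ) * (τ : ℂ)) := by push_cast; ring
    rw [h5, piCot_neg (e_add_int_mul_ne_one (neg_notMem hz) _)]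
    push_cast; rfl
  have h3 := ((tendsto_add_atTop_iff_nat 1).2 (tendsto_piCot_add (τ := τ) z)).sub h2
  have := tendsto_nhds_unique h1 h3
  linear_combination this

lemma E1Deriv_add_one {τ : ℍ} {z : ℂ} (b : ℕ) (hz : z ∉ lattice τ) :
    E1Deriv b τ (z + 1) = E1Deriv b τ z :=
  (hasSingularPartials_E1Deriv b).1.periodic_z τ z hz

/-- The additive constant in the quasi-period of `E₁` disappears after one differentiation in `z`.
-/
lemma E1Deriv_succ_add_tau (b : ℕ) {τ : ℍ} {z : ℂ} (hz : z ∉ lattice τ) :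
    E1Deriv (b + 1) τ (z + τ) = E1Deriv (b + 1) τ z := by
  have hstep : ∀ (b : ℕ) (c : ℂ) (z : ℂ), z ∉ lattice τ →
      (∀ w, w ∉ lattice τ → E1Deriv b τ (w + τ) = E1Deriv b τ w - c) →
      E1Deriv (b + 1) τ (z + τ) = E1Deriv (b + 1) τ z := by
    intro b c z hz h
    have hz' : z + τ ∉ lattice τ := by rwa [add_mem_lattice_iff (coe_mem_lattice τ)]
    have h1 : (fun w => E1Deriv b τ (w + τ)) =ᶠ[𝓝 z] fun w => E1Deriv b τ w - c := by
      filter_upwards [eventually_notMem_lattice_of_notMem hz] with w hw using h w hw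
    rw [← (hasDerivAt_E1Deriv b hz').deriv, ← deriv_comp_add_const, h1.deriv_eq]
    exact ((hasDerivAt_E1Deriv b hz).sub_const c).deriv
  induction b generalizing z with
  | zero => exact hstep 0 _ z hz fun w hw => E1Deriv_zero_add_tau hw
  | succ b ih => exact hstep (b + 1) 0 z hz fun w hw => by rw [ih hw, sub_zero]

lemma eq_add_int_mul_of_eq_add {P : ℂ → Prop} {F : ℂ → ℂ} {w c : ℂ} (hP : ∀ z, P z ↔ P (z + w))
    (h : ∀ z, P z → F (z + w) = F z + c) (n : ℤ) : ∀ z, P z → F (z + n * w) = F z + n * c := by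
  induction n with
  | zero => simp
  | succ n ih =>
    intro z hz
    have := ih (z + w) ((hP z).1 hz)
    rw [h z hz] at this
    push_cast at this ⊢
    rw [show z + ((n : ℂ) + 1) * w = z + w + n * w by ring, this]
    ring
  | pred n ih =>
    intro z hz
    have hz' : P (z - w) := by rw [hP, sub_add_cancel]; exact hz
    have h1 := ih (z - w) hz'
    have h2 := h (z - w) hz'
    rw [sub_add_cancel] at h2
    push_cast at h1 ⊢
    rw [show z + (-(n : ℂ) - 1) * w = z - w + -n * w by ring, h1, h2]
    ring

lemma E1Deriv_zero_add_lattice {τ : ℍ} (m n : ℤ) {z : ℂ} (hz : z ∉ lattice τ) :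
    E1Deriv 0 τ (z + (m + n * τ)) = E1Deriv 0 τ z - n * (2 * Real.pi * Complex.I) := by
  have h1 := eq_add_int_mul_of_eq_add (P := fun z => z ∉ lattice τ) (F := E1Deriv 0 τ) (w := τ)
    (c := -(2 * Real.pi * Complex.I))
    (fun z => not_congr (add_mem_lattice_iff (coe_mem_lattice τ)).symm)
    (fun z hz => by rw [E1Deriv_zero_add_tau hz]; ring) n
  have h2 := eq_add_int_mul_of_eq_add (P := fun z => z ∉ lattice τ) (F := E1Deriv 0 τ) (w := 1)
    (c := 0) (fun z => not_congr (add_mem_lattice_iff (one_mem_lattice τ)).symm)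
    (fun z hz => by rw [E1Deriv_add_one 0 hz]; ring) m z hz
  have hz' : z + m * 1 ∉ lattice τ := by rwa [add_mem_lattice_iff ⟨m, 0, by simp⟩]
  have h3 := h1 _ hz'
  rw [h2] at h3
  rw [show z + ((m : ℂ) + n * τ) = z + m * 1 + n * τ by ring, h3]
  ring

/-- The regular part at `0` of the derivatives of `E₁`. -/
lemma exists_E1Deriv_eq_add (b : ℕ) : ∃ r : ℍ → ℂ → ℂ, TaylorHolomorphic r ∧
    ∀ τ, ∀ᶠ z in 𝓝[≠] (0 : ℂ),
      E1Deriv b τ z = (-1) ^ b * b.factorial * (z ^ (b + 1))⁻¹ + r τ z := by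
  obtain ⟨ρ, hρ, h⟩ := exists_psi_e_eq_add b
  refine ⟨fun τ z => (if b = 0 then -(Real.pi * Complex.I) else 0) +
    -(2 * Real.pi * Complex.I) ^ (b + 1) * (ρ z + (lambertSeries 0 b 1 τ z +
      (-1) ^ (b + 1) * lambertSeries 0 b (-1) τ z)), ?_, fun τ => ?_⟩
  · refine (TaylorHolomorphic.of_const analyticAt_const).add
      ((TaylorHolomorphic.of_const analyticAt_const).mul ?_)
    exact (TaylorHolomorphic.of_const hρ).add
      ((taylorHolomorphic_lambertSeries 0 b (Or.inl rfl)).add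
        ((TaylorHolomorphic.of_const analyticAt_const).mul
          (taylorHolomorphic_lambertSeries 0 b (Or.inr rfl))))
  · filter_upwards [h] with z hz
    have hpi := pow_ne_zero (b + 1) Complex.two_pi_I_ne_zero
    rw [E1Deriv, hz]
    field_simp
    ring

/-! ### Liouville's theorem for quasi-periodic functions -/

lemma isBounded_range_of_periodic {τ : ℍ} {G : ℂ → ℂ} (hG : Continuous G)
    (h1 : ∀ z, G (z + 1) = G z) (hτ : ∀ z, G (z + τ) = G z) : Bornology.IsBounded (Set.range G) := by
  have hper : ∀ (m n : ℤ) (z : ℂ), G (z + m + n * τ) = G z := fun m n z => by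
    have e1 := eq_add_int_mul_of_eq_add (P := fun _ => True) (F := G) (w := 1) (c := 0)
      (fun _ => Iff.rfl) (fun z _ => by rw [h1, add_zero]) m z trivial
    have e2 := eq_add_int_mul_of_eq_add (P := fun _ => True) (F := G) (w := τ) (c := 0)
      (fun _ => Iff.rfl) (fun z _ => by rw [hτ, add_zero]) n (z + m) trivial
    rw [mul_one, mul_zero, add_zero] at e1
    rw [e2, e1, mul_zero, add_zero]
  have hK : IsCompact ((fun p : ℝ × ℝ => G ((p.1 : ℂ) + (p.2 : ℂ) * τ)) ''
      (Set.Icc (0 : ℝ) 1 ×ˢ Set.Icc (0 : ℝ) 1)) :=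
    (isCompact_Icc.prod isCompact_Icc).image (by fun_prop)
  refine hK.isBounded.subset ?_
  rintro _ ⟨z, rfl⟩
  set y : ℝ := z.im / τ.im with hy
  set x : ℝ := z.re - y * τ.re with hx
  have hz : z = x + y * τ := by
    refine Complex.ext ?_ ?_
    · simp [Complex.mul_re, hx]
    · simp [Complex.mul_im, hy, τ.im_ne_zero]
  refine ⟨(Int.fract x, Int.fract y), ⟨⟨Int.fract_nonneg x, (Int.fract_lt_one x).le⟩,
    ⟨Int.fract_nonneg y, (Int.fract_lt_one y).le⟩⟩, ?_⟩
  have hxf : (x : ℂ) = Int.fract x + ⌊x⌋ := by exact_mod_cast (Int.fract_add_floor x).symm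
  have hyf : (y : ℂ) = Int.fract y + ⌊y⌋ := by exact_mod_cast (Int.fract_add_floor y).symm
  rw [hz, hxf, hyf]
  simp only
  rw [← hper ⌊x⌋ ⌊y⌋]
  congr 1
  ring

/-- Translation by the lattice changes `h` only by a constant, so the removable singularity at `0`
is carried to every lattice point. -/
lemma exists_entire_extension {τ : ℍ} {h : ℂ → ℂ} {β : ℂ}
    (han : ∀ z, z ∉ lattice τ → AnalyticAt ℂ h z)
    (h1 : ∀ z, z ∉ lattice τ → h (z + 1) = h z)
    (hτ : ∀ z, z ∉ lattice τ → h (z + τ) = h z + β)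
    {u : ℂ → ℂ} (hu : AnalyticAt ℂ u 0) (h0 : ∀ᶠ z in 𝓝[≠] (0 : ℂ), h z = u z) :
    ∃ H : ℂ → ℂ, Differentiable ℂ H ∧ ∀ z, z ∉ lattice τ → H z = h z := by
  have hloc : ∀ w, ∃ v : ℂ → ℂ, AnalyticAt ℂ v w ∧ ∀ᶠ z in 𝓝[≠] w, h z = v z := by
    intro w
    by_cases hw : w ∈ lattice τ
    · obtain ⟨m, n, rfl⟩ := hw
      refine ⟨fun z => u (z - (m + n * τ)) + n * β, ?_, ?_⟩
      · refine AnalyticAt.add (AnalyticAt.fun_comp ?_ (by fun_prop)) analyticAt_const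
        simpa using hu
      · filter_upwards [(tendsto_sub_nhdsNE ((m : ℂ) + n * τ)).eventually h0,
          (tendsto_sub_nhdsNE ((m : ℂ) + n * τ)).eventually (eventually_notMem_lattice_zero τ)]
          with z hz hzl
        rw [← hz]
        have hzl' : z - (m + n * τ) + m * 1 ∉ lattice τ := by
          rwa [add_mem_lattice_iff ⟨m, 0, by simp⟩]
        have e1 := eq_add_int_mul_of_eq_add (P := fun z => z ∉ lattice τ) (F := h) (w := 1)
          (c := 0) (fun z => not_congr (add_mem_lattice_iff (one_mem_lattice τ)).symm)
          (fun z hz => by rw [h1 z hz, add_zero]) m _ hzl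
        have e2 := eq_add_int_mul_of_eq_add (P := fun z => z ∉ lattice τ) (F := h) (w := τ)
          (c := β) (fun z => not_congr (add_mem_lattice_iff (coe_mem_lattice τ)).symm)
          hτ n _ hzl'
        rw [e1] at e2
        rw [mul_zero, add_zero] at e2
        rw [← e2]
        congr 1
        ring
    · exact ⟨h, han w hw, Eventually.of_forall fun _ => rfl⟩
  choose v hv hvh using hloc
  have hval : ∀ w, w ∉ lattice τ → v w w = h w := fun w hw => by
    have c1 := (hv w).continuousAt.tendsto.mono_left (nhdsWithin_le_nhds (s := {w}ᶜ))
    have c2 := (han w hw).continuousAt.tendsto.mono_left (nhdsWithin_le_nhds (s := {w}ᶜ))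
    exact tendsto_nhds_unique (c1.congr' ((hvh w).mono fun _ h => h.symm)) c2
  refine ⟨fun w => v w w, fun w => ?_, hval⟩
  have heq : (fun z => v z z) =ᶠ[𝓝 w] v w := by
    have : ∀ᶠ z in 𝓝[≠] w, v z z = v w z := by
      filter_upwards [hvh w, eventually_notMem_lattice τ w] with z hz hzl
      rw [hval z hzl, hz]
    rw [eventually_nhdsWithin_iff] at this
    filter_upwards [this] with z hz
    by_cases hzw : z = w
    · rw [hzw]
    · exact hz hzw
  exact (hv w).differentiableAt.congr_of_eventuallyEq heq

/-- The derivative of the entire extension is doubly periodic, hence constant by Liouville. The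
extension is then affine, and its period `1` kills the slope. -/
lemma exists_eq_const_of_quasiperiodic {τ : ℍ} {h : ℂ → ℂ} {β : ℂ}
    (han : ∀ z, z ∉ lattice τ → AnalyticAt ℂ h z)
    (h1 : ∀ z, z ∉ lattice τ → h (z + 1) = h z)
    (hτ : ∀ z, z ∉ lattice τ → h (z + τ) = h z + β)
    {u : ℂ → ℂ} (hu : AnalyticAt ℂ u 0) (h0 : ∀ᶠ z in 𝓝[≠] (0 : ℂ), h z = u z) :
    ∃ c, ∀ z, z ∉ lattice τ → h z = c := by
  obtain ⟨H, hH, hHh⟩ := exists_entire_extension han h1 hτ hu h0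
  have hc := hH.continuous
  have hH1 : ∀ z, H (z + 1) = H z := by
    refine congrFun (Continuous.ext_on (dense_compl_lattice τ) (by fun_prop) hc fun z hz => ?_)
    rw [hHh z hz, hHh _ (by rwa [add_mem_lattice_iff (one_mem_lattice τ)]), h1 z hz]
  have hHτ : ∀ z, H (z + τ) = H z + β := by
    refine congrFun (Continuous.ext_on (dense_compl_lattice τ) (by fun_prop) (by fun_prop)
      fun z hz => ?_)
    rw [hHh z hz, hHh _ (by rwa [add_mem_lattice_iff (coe_mem_lattice τ)]), hτ z hz]
  have hd : Differentiable ℂ (deriv H) := fun z =>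
    (hH.analyticAt z).deriv.differentiableAt
  have hd1 : ∀ z, deriv H (z + 1) = deriv H z := fun z => by
    rw [← deriv_comp_add_const]
    simp only [hH1]
  have hdτ : ∀ z, deriv H (z + τ) = deriv H z := fun z => by
    rw [← deriv_comp_add_const]
    simp only [hHτ, deriv_add_const]
  have hbdd := isBounded_range_of_periodic hd.continuous hd1 hdτ
  have hder : ∀ z, deriv H z = deriv H 0 := fun z => hd.apply_eq_apply_of_bounded hbdd z 0
  set a := deriv H 0 with ha
  have hconst : ∀ z, H z - a * z = H 0 - a * 0 := by
    intro z
    refine is_const_of_deriv_eq_zero (f := fun z => H z - a * z) (by fun_prop) (fun w => ?_) z 0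
    have := (hH w).hasDerivAt.sub ((hasDerivAt_id w).const_mul a)
    refine this.deriv.trans ?_
    rw [hder w]; ring
  have ha0 : a = 0 := by
    have e1 := hconst 1
    have e2 := hH1 0
    rw [zero_add] at e2
    rw [e2] at e1
    linear_combination -e1
  refine ⟨H 0, fun z hz => ?_⟩
  rw [← hHh z hz]
  have := hconst z
  rw [ha0] at this
  linear_combination this

/-! ### Singular functions that are elliptic -/

/-- By the Leibniz rule for `z * v`, the `n`-th derivative of `v` at `0` is that of `u` of order `n
+ 1` divided by `n + 1`; division by `z` therefore keeps the coefficients holomorphic in `τ`. -/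
lemma TaylorHolomorphic.exists_eq_add_mul {u : ℍ → ℂ → ℂ} (hu : TaylorHolomorphic u) :
    ∃ v : ℍ → ℂ → ℂ, TaylorHolomorphic v ∧ ∀ τ z, u τ z = u τ 0 + z * v τ z := by
  have hv := fun τ => exists_eq_add_mul_of_analyticAt (hu.analyticAt τ)
  refine ⟨fun τ => dslope (u τ) 0, ⟨fun τ => (hv τ).1, fun n => ?_⟩, fun τ => (hv τ).2⟩
  have key : ∀ τ, iteratedDeriv n (dslope (u τ) 0) 0 =
      ((n : ℂ) + 1)⁻¹ * iteratedDeriv (n + 1) (u τ) 0 := by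
    intro τ
    have hn : ((n : ℂ) + 1) ≠ 0 := by exact_mod_cast Nat.succ_ne_zero n
    have h1 : iteratedDeriv (n + 1) (u τ) 0 =
        iteratedDeriv (n + 1) (fun z => z * dslope (u τ) 0 z) 0 := by
      have : u τ = fun z => u τ 0 + z * dslope (u τ) 0 z := funext (hv τ).2
      conv_lhs => rw [this]
      rw [iteratedDeriv_succ', iteratedDeriv_succ']
      congr 1
      ext z
      rw [deriv_const_add]
    have h2 := iteratedDeriv_fun_mul (n := n + 1) (f := fun z : ℂ => z) (g := dslope (u τ) 0)
      (x := (0 : ℂ)) (by fun_prop) (hv τ).1.contDiffAt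
    rw [h1, h2, Finset.sum_eq_single 1]
    · have : iteratedDeriv 1 (fun z : ℂ => z) 0 = 1 := by simp [iteratedDeriv_one]
      rw [this, Nat.choose_one_right, Nat.add_sub_cancel]
      push_cast
      field_simp
    · intro i _ hi
      have : iteratedDeriv i (fun z : ℂ => z) 0 = 0 := by
        rcases i with _ | _ | i
        · simp
        · exact absurd rfl hi
        · rw [iteratedDeriv_succ', iteratedDeriv_succ']
          simp
      rw [this]; ring
    · intro h
      exact absurd (Finset.mem_range.2 (by lia)) h
  simp only [key]
  exact (HolomorphicAtInfinity.const _).mul (hu.coeff _)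

/-- Induction on the pole order at `0`: subtracting a multiple of the `N`-th derivative of `E₁`
removes the pole of order `N + 1`. Constants `β τ` must be allowed even for elliptic `f`, because
removing a simple pole uses `E₁` itself, which is only quasi-periodic. Without poles, `f` equals the
constant `u τ 0` in `z`. -/
lemma hasSingularPartials_of_quasiperiodic (N : ℕ) : ∀ (f u : ℍ → ℂ → ℂ) (β : ℍ → ℂ),
    IsSingular f → (∀ τ z, z ∉ lattice τ → f τ (z + τ) = f τ z + β τ) → TaylorHolomorphic u →
    (∀ τ, ∀ᶠ z in 𝓝[≠] (0 : ℂ), f τ z = (z ^ N)⁻¹ * u τ z) → HasSingularPartials f := by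
  induction N with
  | zero =>
    intro f u β hf hβ hu hfu
    have hA : HolomorphicAtInfinity fun τ => u τ 0 := by simpa using hu.coeff 0
    refine (HasSingularPartials.of_holomorphicAtInfinity hA).congr fun τ z hz => ?_
    have h0 : ∀ᶠ z in 𝓝[≠] (0 : ℂ), f τ z = u τ z := by simpa using hfu τ
    obtain ⟨c, hc⟩ := exists_eq_const_of_quasiperiodic (hf.analyticAt τ) (hf.periodic_z τ) (hβ τ)
      (hu.analyticAt τ) h0
    rw [hc z hz]
    have c1 := (hu.analyticAt τ).continuousAt.tendsto.mono_left
      (nhdsWithin_le_nhds (s := {(0 : ℂ)}ᶜ))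
    have c2 : ∀ᶠ z in 𝓝[≠] (0 : ℂ), u τ z = c := by
      filter_upwards [h0, eventually_notMem_lattice_zero τ] with w hw hw'
      rw [← hw, hc w hw']
    exact tendsto_nhds_unique (tendsto_const_nhds.congr' (c2.mono fun _ h => h.symm)) c1
  | succ N ih =>
    intro f u β hf hβ hu hfu
    obtain ⟨v, hv, huv⟩ := hu.exists_eq_add_mul
    obtain ⟨r, hr, hEr⟩ := exists_E1Deriv_eq_add N
    have hA : HolomorphicAtInfinity fun τ => u τ 0 := by simpa using hu.coeff 0
    set κ : ℂ := (-1) ^ N * (N.factorial : ℂ) with hκ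
    have hκ0 : κ ≠ 0 := mul_ne_zero (pow_ne_zero _ (by norm_num))
      (by exact_mod_cast N.factorial_ne_zero)
    have hsub : HasSingularPartials fun τ z => κ⁻¹ * (u τ 0 * E1Deriv N τ z) :=
      ((HasSingularPartials.of_holomorphicAtInfinity hA).mul
        (hasSingularPartials_E1Deriv N)).const_mul κ⁻¹
    obtain ⟨β', hβ'⟩ : ∃ β' : ℂ, ∀ τ z, z ∉ lattice τ →
        E1Deriv N τ (z + τ) = E1Deriv N τ z + β' := by
      rcases N with _ | N
      · exact ⟨-(2 * Real.pi * Complex.I), fun τ z hz => by rw [E1Deriv_zero_add_tau hz]; ring⟩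
      · exact ⟨0, fun τ z hz => by rw [E1Deriv_succ_add_tau N hz, add_zero]⟩
    have hg := ih (fun τ z => f τ z - κ⁻¹ * (u τ 0 * E1Deriv N τ z))
      -- The leading coefficients cancel: `z ^ (-(N + 1)) (u₀ + z v) - κ⁻¹ u₀ (κ z ^ (-(N + 1)) +
      -- r)` equals `z ^ (-N) (v - κ⁻¹ z ^ N u₀ r)`, where `u₀ = u τ 0`.
      (fun τ z => v τ z + (-κ⁻¹ * z ^ N) * (u τ 0 * r τ z))
      (fun τ => β τ - κ⁻¹ * (u τ 0 * β')) (hf.sub hsub.1)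
      (fun τ z hz => by rw [hβ τ z hz, hβ' τ z hz]; ring)
      (hv.add ((TaylorHolomorphic.of_const (by fun_prop)).mul
        ((TaylorHolomorphic.of_holomorphicAtInfinity hA).mul hr)))
      (fun τ => by
        filter_upwards [hfu τ, hEr τ, self_mem_nhdsWithin] with z hz hz' h0
        have h0 : z ≠ 0 := h0
        rw [hz, hz', huv]
        field_simp
        ring)
    exact (hg.add hsub).congr fun τ z _ => by ring

lemma IsSingular.hasSingularPartials_of_elliptic {f : ℍ → ℂ → ℂ} (hf : IsSingular f)
    (hτ : ∀ τ z, z ∉ lattice τ → f τ (z + τ) = f τ z) : HasSingularPartials f := by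
  obtain ⟨N, u, hu, hfu⟩ := hf.exists_taylor
  exact hasSingularPartials_of_quasiperiodic N f u 0 hf (fun τ z hz => by simp [hτ τ z hz]) hu hfu

/-! ### The transformation laws of `E₁` and `e₂` -/

/-- The term linear in `z` is chosen so that the quasi-periods on the two sides agree, and the poles
`1/z` at `0` cancel. The difference is thus constant by Liouville, and a constant odd function is
zero. -/
lemma E1Deriv_zero_smul (A : JacobiElt) {τ : ℍ} {z : ℂ} (hz : z ∉ lattice τ) :
    E1Deriv 0 (A.g • τ) (z / J A τ) / J A τ =
      E1Deriv 0 τ z + 2 * Real.pi * Complex.I * ((A.g 1 0 : ℂ) * z / J A τ) := by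
  have hJ := J_ne_zero A τ
  have hdet := det_eq A.g
  have hsm := coe_smul_eq A τ
  have hJd : J A τ = (A.g 1 0 : ℂ) * τ + (A.g 1 1 : ℂ) := rfl
  have hmem : ∀ z, z ∉ lattice τ → z / J A τ ∉ lattice (A.g • τ) := fun z hz => by
    rwa [div_J_mem_lattice_iff]
  set h : ℂ → ℂ := fun z => E1Deriv 0 (A.g • τ) (z / J A τ) / J A τ - E1Deriv 0 τ z -
    2 * Real.pi * Complex.I * ((A.g 1 0 : ℂ) * z / J A τ) with hh
  obtain ⟨r, hr, hEr⟩ := exists_E1Deriv_eq_add 0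
  have hconst : ∃ c, ∀ z, z ∉ lattice τ → h z = c := by
    refine exists_eq_const_of_quasiperiodic (β := 0) (fun z hz => ?_) (fun z hz => ?_)
      (fun z hz => ?_)
      (u := fun z => r (A.g • τ) (z / J A τ) / J A τ - r τ z -
        2 * Real.pi * Complex.I * ((A.g 1 0 : ℂ) * z / J A τ)) ?_ ?_
    · have a1 := (hasSingularPartials_E1Deriv 0).1.analyticAt (A.g • τ) _ (hmem z hz)
      have a2 := (hasSingularPartials_E1Deriv 0).1.analyticAt τ z hz
      have a3 : AnalyticAt ℂ (fun z => E1Deriv 0 (A.g • τ) (z / J A τ)) z :=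
        AnalyticAt.fun_comp (f := fun z => z / J A τ) a1 (by fun_prop (disch := assumption))
      exact ((a3.div_const).sub a2).sub (by fun_prop (disch := assumption))
    · have e1 : (z + 1) / J A τ = z / J A τ +
          (((A.g 0 0 : ℤ) : ℂ) + ((-A.g 1 0 : ℤ) : ℂ) * ((A.g • τ : ℍ) : ℂ)) := by
        rw [hsm]
        field_simp
        rw [hJd]
        push_cast
        linear_combination -hdet
      simp only [hh]
      rw [e1, E1Deriv_zero_add_lattice _ _ (hmem z hz), E1Deriv_add_one 0 hz]
      push_cast
      field_simp
      ring
    · have e1 : (z + τ) / J A τ = z / J A τ +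
          (((-A.g 0 1 : ℤ) : ℂ) + ((A.g 1 1 : ℤ) : ℂ) * ((A.g • τ : ℍ) : ℂ)) := by
        rw [hsm]
        field_simp
        rw [hJd]
        push_cast
        linear_combination (-(τ : ℂ)) * hdet
      simp only [hh]
      rw [e1, E1Deriv_zero_add_lattice _ _ (hmem z hz), E1Deriv_zero_add_tau hz]
      field_simp
      rw [hJd]
      ring
    · have a3 : AnalyticAt ℂ (fun z => r (A.g • τ) (z / J A τ)) 0 :=
        AnalyticAt.fun_comp (f := fun z => z / J A τ) (by simpa using hr.analyticAt (A.g • τ))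
          (by fun_prop (disch := assumption))
      exact ((a3.div_const).sub (hr.analyticAt τ)).sub (by fun_prop (disch := assumption))
    · have hmap : Tendsto (fun z => z / J A τ) (𝓝[≠] 0) (𝓝[≠] 0) := by
        refine tendsto_nhdsWithin_of_tendsto_nhds_of_eventually_within _ ?_ ?_
        · have : Tendsto (fun z => z / J A τ) (𝓝 0) (𝓝 (0 / J A τ)) :=
            Continuous.tendsto (by fun_prop) _
          rw [zero_div] at this
          exact this.mono_left nhdsWithin_le_nhds
        · filter_upwards [self_mem_nhdsWithin] with z hz
          exact div_ne_zero hz hJ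
      filter_upwards [hmap.eventually (hEr (A.g • τ)), hEr τ, self_mem_nhdsWithin] with z h1 h2 h0
      have h0 : z ≠ 0 := h0
      simp only [hh]
      rw [h1, h2]
      simp only [pow_zero, Nat.factorial_zero, Nat.cast_one, one_mul, zero_add, pow_one]
      field_simp
      ring
  obtain ⟨c, hc⟩ := hconst
  have hodd : h (-z) = -h z := by
    simp only [hh]
    rw [neg_div, E1Deriv_zero_neg (hmem z hz), E1Deriv_zero_neg hz]
    ring
  rw [hc z hz, hc _ (neg_notMem hz)] at hodd
  have hc0 : c = 0 := by linear_combination hodd / 2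
  have := hc z hz
  rw [hc0] at this
  simp only [hh] at this
  linear_combination this

lemma E1_slash (A : JacobiElt) {τ : ℍ} {z : ℂ} (hz : z ∉ lattice τ) :
    E1 (A.g • τ) ((z + (A.l : ℂ) * (τ : ℂ) + (A.m : ℂ)) / J A τ) / J A τ =
      E1 τ z + 2 * Real.pi * Complex.I * Y A τ z := by
  have hJ := J_ne_zero A τ
  have hz' : z + (A.m + A.l * τ) ∉ lattice τ := by
    rwa [add_mem_lattice_iff ⟨A.m, A.l, rfl⟩]
  rw [E1_eq ((slash_arg_mem_lattice_iff A τ z).not.2 hz), E1_eq hz,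
    show z + (A.l : ℂ) * (τ : ℂ) + (A.m : ℂ) = z + (A.m + A.l * τ) by ring,
    E1Deriv_zero_smul A hz', E1Deriv_zero_add_lattice _ _ hz, Y]
  have hJd : J A τ = (A.g 1 0 : ℂ) * τ + (A.g 1 1 : ℂ) := rfl
  field_simp
  rw [hJd]
  ring

lemma e2_eq_E2 (τ : ℍ) : e2 τ = (Real.pi : ℂ) ^ 2 / 3 * EisensteinSeries.E2 τ := by
  rw [EisensteinSeries.E2_eq_tsum_cexp, e2]
  congr 3
  have h := tsum_zero_pnat_eq_tsum_nat
    (EisensteinSeries.summable_sigma_mul_cexp_pow (k := 2) one_le_two τ)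
  simp only [ArithmeticFunction.map_zero, Nat.cast_zero, zero_mul, zero_add,
    Nat.add_one_sub_one] at h
  rw [h]
  refine tsum_congr fun n => ?_
  rw [← Complex.exp_nat_mul]
  ring_nf

lemma e2_eq (τ : ℍ) : e2 τ = EisensteinSeries.G2 τ := by
  have hpi : (Real.pi : ℂ) ≠ 0 := by exact_mod_cast Real.pi_ne_zero
  rw [e2_eq_E2]
  simp only [EisensteinSeries.E2, Pi.smul_apply, smul_eq_mul, riemannZeta_two]
  field_simp
  norm_num

/-- The function `e2` is the weight-two Eisenstein series `G2`, whose defect of modularity `D2` is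
`2πi c/(cτ + d)`. -/
lemma e2_smul (A : JacobiElt) (τ : ℍ) :
    e2 (A.g • τ) / J A τ ^ 2 = e2 τ - 2 * Real.pi * Complex.I * X A τ := by
  have h := congrFun (EisensteinSeries.G2_slash_action A.g) τ
  rw [ModularForm.SL_slash_apply, Pi.sub_apply, EisensteinSeries.D2, ← J_eq_denom] at h
  rw [e2_eq, e2_eq, X, ← mul_div_assoc, ← h, div_eq_mul_inv]
  congr 1

lemma holomorphicAtInfinity_e2 : HolomorphicAtInfinity e2 := by
  have hE2 : HolomorphicAtInfinity EisensteinSeries.E2 := by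
    refine ⟨E2_mdifferentiable, fun m => if m = 0 then 1 else -24 * ArithmeticFunction.sigma 1 m,
      fun τ => ?_⟩
    refine (EisensteinSeries.hasSum_qExpansion_E2 (z := τ)).congr_fun fun n => ?_
    rw [smul_eq_mul, ← Complex.exp_nat_mul]
    ring_nf
  rw [show e2 = fun τ => (Real.pi : ℂ) ^ 2 / 3 * EisensteinSeries.E2 τ from funext e2_eq_E2]
  exact (HolomorphicAtInfinity.const _).mul hE2

/-! ### The coefficients of a quasi-Jacobi form -/

/-- The matrix `(1 0; c 1)`. -/
def lowerUnipotent (c : ℕ) : SL(2, ℤ) :=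
  ⟨!![1, 0; (c : ℤ), 1], by simp [Matrix.det_fin_two]⟩

lemma J_lowerUnipotent (c : ℕ) (l m : ℤ) (τ : ℍ) :
    J ⟨lowerUnipotent c, l, m⟩ τ = (c : ℂ) * τ + 1 := by
  simp [J, lowerUnipotent]

lemma X_lowerUnipotent (c : ℕ) (l m : ℤ) (τ : ℍ) :
    X ⟨lowerUnipotent c, l, m⟩ τ = (c : ℂ) / ((c : ℂ) * τ + 1) := by
  rw [X, J_lowerUnipotent]; simp [lowerUnipotent]

lemma Y_lowerUnipotent (c : ℕ) (l : ℤ) (τ : ℍ) (z : ℂ) :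
    Y ⟨lowerUnipotent c, l, 0⟩ τ z = ((c : ℂ) * z - l) / ((c : ℂ) * τ + 1) := by
  rw [Y, J_lowerUnipotent]; simp [lowerUnipotent]

lemma natCast_mul_add_one_ne_zero (c : ℕ) (τ : ℍ) : (c : ℂ) * τ + 1 ≠ 0 := by
  rw [← J_lowerUnipotent c 0 0]
  exact J_ne_zero _ _

/-- Uniqueness of coefficients, by two interpolations. For fixed `c`, varying `l` gives infinitely
many values of `Y` while `X` stays fixed, so the polynomial in `Y` vanishes. Its coefficients are
polynomials in `X`, which takes infinitely many values as `c` varies. -/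
lemma eq_zero_of_forall_lowerUnipotent {s : ℕ} (τ : ℍ) (z : ℂ) {P : ℕ → Polynomial ℂ}
    (h : ∀ (c : ℕ) (l : ℤ), ∑ j ∈ Finset.range (s + 1),
      X ⟨lowerUnipotent c, l, 0⟩ τ ^ j * (P j).eval (Y ⟨lowerUnipotent c, l, 0⟩ τ z) = 0) :
    ∀ j ≤ s, P j = 0 := by
  have h1 : ∀ c : ℕ, ∑ j ∈ Finset.range (s + 1),
      Polynomial.C (((c : ℂ) / ((c : ℂ) * τ + 1)) ^ j) * P j = 0 := by
    intro c
    refine Polynomial.eq_zero_of_infinite_isRoot _ (Set.infinite_of_injective_forall_mem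
      (f := fun l : ℤ => ((c : ℂ) * z - l) / ((c : ℂ) * τ + 1)) ?_ fun l => ?_)
    · intro l l' hl
      simp only at hl
      rw [div_left_inj' (natCast_mul_add_one_ne_zero c τ), sub_right_inj] at hl
      exact_mod_cast hl
    · have := h c l
      simp only [X_lowerUnipotent, Y_lowerUnipotent] at this
      simpa [Polynomial.IsRoot.def, Polynomial.eval_finsetSum] using this
  have h2 : ∀ n : ℕ, ∑ j ∈ Finset.range (s + 1),
      Polynomial.C ((P j).coeff n) * Polynomial.X ^ j = 0 := by
    intro n
    refine Polynomial.eq_zero_of_infinite_isRoot _ (Set.infinite_of_injective_forall_mem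
      (f := fun c : ℕ => (c : ℂ) / ((c : ℂ) * τ + 1)) ?_ fun c => ?_)
    · intro c c' hc
      simp only at hc
      rw [div_eq_div_iff (natCast_mul_add_one_ne_zero c τ) (natCast_mul_add_one_ne_zero c' τ)]
        at hc
      have : (c : ℂ) = c' := by linear_combination hc
      exact_mod_cast this
    · have := congrArg (fun p => Polynomial.coeff p n) (h1 c)
      simp only [Polynomial.finsetSum_coeff, Polynomial.coeff_C_mul, Polynomial.coeff_zero] at this
      change Polynomial.eval _ _ = 0
      rw [Polynomial.eval_finsetSum, ← this]
      refine Finset.sum_congr rfl fun j _ => ?_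
      rw [Polynomial.eval_mul, Polynomial.eval_C, Polynomial.eval_pow, Polynomial.eval_X, mul_comm]
  intro j hj
  ext n
  have := congrArg (fun p => Polynomial.coeff p j) (h2 n)
  simp only [Polynomial.finsetSum_coeff, Polynomial.coeff_C_mul, Polynomial.coeff_X_pow,
    Polynomial.coeff_zero, mul_ite, mul_one, mul_zero] at this
  rw [Finset.sum_ite_eq, if_pos (Finset.mem_range.2 (by lia))] at this
  rw [this, Polynomial.coeff_zero]

/-- The polynomial `∑_{j ≤ s} h_j(τ, z) T^j`. -/
def coeffPoly (s : ℕ) (h : ℕ → ℍ → ℂ → ℂ) (τ : ℍ) (z : ℂ) : Polynomial ℂ :=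
  ∑ j ∈ Finset.range (s + 1), Polynomial.C (h j τ z) * Polynomial.X ^ j

lemma coeff_taylor_sum (s : ℕ) (a : ℕ → ℂ) (r : ℂ) (n : ℕ) :
    (Polynomial.taylor r (∑ j ∈ Finset.range (s + 1),
      Polynomial.C (a j) * Polynomial.X ^ j)).coeff n =
      ∑ j ∈ Finset.range (s + 1), a j * (r ^ (j - n) * (j.choose n : ℂ)) := by
  rw [map_sum, Polynomial.finsetSum_coeff]
  refine Finset.sum_congr rfl fun j _ => ?_
  rw [Polynomial.taylor_apply, Polynomial.mul_comp, Polynomial.C_comp, Polynomial.X_pow_comp,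
    Polynomial.coeff_C_mul, Polynomial.coeff_X_add_C_pow]

/-- Replacing `z` by `z + τ` in the action has the same effect as replacing `l` by `l + 1`. This
keeps `X` and translates `Y` by `-1`, so uniqueness of the coefficients yields the translation of
the polynomial. -/
lemma coeffPoly_add_tau {k s₁ s₂ : ℕ} {f : ℍ → ℂ → ℂ} {q : ℕ → ℕ → ℍ → ℂ → ℂ}
    (h : ∀ (A : JacobiElt) (τ : ℍ) (z : ℂ), z ∉ lattice τ →
        slash k f A τ z =
          ∑ j₁ ∈ Finset.range (s₁ + 1), ∑ j₂ ∈ Finset.range (s₂ + 1),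
            q j₁ j₂ τ z * X A τ ^ j₁ * Y A τ z ^ j₂)
    {τ : ℍ} {z : ℂ} (hz : z ∉ lattice τ) {j : ℕ} (hj : j ≤ s₁) :
    coeffPoly s₂ (q j) τ (z + τ) = Polynomial.taylor (-1) (coeffPoly s₂ (q j) τ z) := by
  have hz' : z + τ ∉ lattice τ := by rwa [add_mem_lattice_iff (coe_mem_lattice τ)]
  refine sub_eq_zero.1 (eq_zero_of_forall_lowerUnipotent (s := s₁) τ (z + τ)
    (P := fun j => coeffPoly s₂ (q j) τ (z + τ) -
      Polynomial.taylor (-1) (coeffPoly s₂ (q j) τ z)) (fun c l => ?_) j hj)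
  have hY : Y ⟨lowerUnipotent c, l + 1, 0⟩ τ z = Y ⟨lowerUnipotent c, l, 0⟩ τ (z + τ) + -1 := by
    rw [Y_lowerUnipotent, Y_lowerUnipotent]
    have := natCast_mul_add_one_ne_zero c τ
    field_simp
    push_cast
    ring
  have hX : X ⟨lowerUnipotent c, l + 1, 0⟩ τ = X ⟨lowerUnipotent c, l, 0⟩ τ := by
    rw [X_lowerUnipotent, X_lowerUnipotent]
  have hs : slash k f ⟨lowerUnipotent c, l + 1, 0⟩ τ z =
      slash k f ⟨lowerUnipotent c, l, 0⟩ τ (z + τ) := by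
    simp only [slash, J_lowerUnipotent]
    congr 3
    push_cast
    ring
  rw [h _ τ z hz, h _ τ _ hz', hX, hY] at hs
  have hev : ∀ (s : ℕ) (g : ℕ → ℍ → ℂ → ℂ) (τ : ℍ) (z y : ℂ), (coeffPoly s g τ z).eval y =
      ∑ j ∈ Finset.range (s + 1), g j τ z * y ^ j := fun s g τ z y => by
    simp [coeffPoly, Polynomial.eval_finsetSum]
  simp only [Polynomial.eval_sub, Polynomial.taylor_eval, hev, mul_sub, Finset.sum_sub_distrib]
  rw [sub_eq_zero]
  refine Eq.trans ?_ (hs.symm.trans ?_)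
  all_goals
    refine Finset.sum_congr rfl fun j _ => ?_
    rw [Finset.mul_sum]
    exact Finset.sum_congr rfl fun i _ => by ring

/-- Singular functions that are mixed unipotently by `z ↦ z + τ` are polynomials in `E₁` with
elliptic coefficients. -/
lemma hasSingularPartials_of_coeffPoly {s : ℕ} {h : ℕ → ℍ → ℂ → ℂ}
    (hs : ∀ j ≤ s, IsSingular (h j))
    (hτ : ∀ τ z, z ∉ lattice τ →
      coeffPoly s h τ (z + τ) = Polynomial.taylor (-1) (coeffPoly s h τ z)) :
    ∀ j ≤ s, HasSingularPartials (h j) := by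
  set ε : ℍ → ℂ → ℂ := fun τ z => (2 * Real.pi * Complex.I)⁻¹ * E1Deriv 0 τ z with hε
  have hεs : HasSingularPartials ε := (hasSingularPartials_E1Deriv 0).const_mul _
  have hετ : ∀ τ z, z ∉ lattice τ → ε τ (z + τ) = ε τ z - 1 := fun τ z hz => by
    simp only [hε]
    rw [E1Deriv_zero_add_tau hz, mul_sub, inv_mul_cancel₀ Complex.two_pi_I_ne_zero]
  -- After `z ↦ z + τ` the two translations compose to the original one, since `-(ε - 1) + (-1) =
  -- -ε`; hence every `g n` is elliptic.
  set g : ℕ → ℍ → ℂ → ℂ := fun n τ z =>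
    (Polynomial.taylor (-ε τ z) (coeffPoly s h τ z)).coeff n with hg
  have hgsum : ∀ n τ z, g n τ z = ∑ j ∈ Finset.range (s + 1),
      h j τ z * ((-1 * ε τ z) ^ (j - n) * (j.choose n : ℂ)) := fun n τ z => by
    simp only [hg, coeffPoly, coeff_taylor_sum, neg_one_mul]
  have hgs : ∀ n, HasSingularPartials (g n) := by
    intro n
    refine IsSingular.hasSingularPartials_of_elliptic ?_ fun τ z hz => ?_
    · refine IsSingular.congr (f := fun τ z => ∑ j ∈ Finset.range (s + 1),
        h j τ z * ((-1 * ε τ z) ^ (j - n) * (j.choose n : ℂ))) ?_ fun τ z _ => hgsum n τ z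
      refine IsSingular.sum _ fun j hj => ?_
      exact (hs j (by simpa [Nat.lt_succ_iff] using hj)).mul
        (((hεs.1.const_mul (-1)).pow _).mul (IsSingular.const _))
    · simp only [hg]
      rw [hετ τ z hz, hτ τ z hz, Polynomial.taylor_taylor,
        show -(ε τ z - 1) + -1 = -ε τ z by ring]
  intro j hj
  -- Translation by `ε` undoes translation by `-ε`, so each `h j` is a polynomial in `ε` with the
  -- elliptic coefficients `g n`.
  have hback : ∀ τ z, h j τ z = ∑ n ∈ Finset.range (s + 1),
      g n τ z * (ε τ z ^ (n - j) * (n.choose j : ℂ)) := by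
    intro τ z
    have hdeg : (Polynomial.taylor (-ε τ z) (coeffPoly s h τ z)).natDegree < s + 1 := by
      rw [Polynomial.natDegree_taylor, Nat.lt_succ_iff]
      refine Polynomial.natDegree_sum_le_of_forall_le _ _ fun i hi => ?_
      exact (Polynomial.natDegree_C_mul_X_pow_le _ _).trans
        (by simpa [Nat.lt_succ_iff] using hi)
    rw [← coeff_taylor_sum]
    simp only [hg]
    rw [← Polynomial.as_sum_range_C_mul_X_pow' _ hdeg, Polynomial.taylor_taylor, add_neg_cancel,
      Polynomial.taylor_zero]
    simp only [coeffPoly, Polynomial.finsetSum_coeff, Polynomial.coeff_C_mul,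
      Polynomial.coeff_X_pow, mul_ite, mul_one, mul_zero]
    rw [Finset.sum_ite_eq, if_pos (Finset.mem_range.2 (by lia))]
  refine HasSingularPartials.congr ?_ fun τ z _ => hback τ z
  exact HasSingularPartials.sum _ fun n _ =>
    (hgs n).mul ((hεs.pow _).mul (HasSingularPartials.const _))

/-- At the identity element `X = Y = 0`, so only the term of index `(0, 0)` survives. -/
lemma eq_of_slash_eq {k s₁ s₂ : ℕ} {f : ℍ → ℂ → ℂ} {q : ℕ → ℕ → ℍ → ℂ → ℂ}
    (h : ∀ (A : JacobiElt) (τ : ℍ) (z : ℂ), z ∉ lattice τ →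
        slash k f A τ z =
          ∑ j₁ ∈ Finset.range (s₁ + 1), ∑ j₂ ∈ Finset.range (s₂ + 1),
            q j₁ j₂ τ z * X A τ ^ j₁ * Y A τ z ^ j₂)
    {τ : ℍ} {z : ℂ} (hz : z ∉ lattice τ) : f τ z = q 0 0 τ z := by
  have h1 := h ⟨1, 0, 0⟩ τ z hz
  have hX : X ⟨1, 0, 0⟩ τ = 0 := by simp [X]
  have hY : Y ⟨1, 0, 0⟩ τ z = 0 := by simp [Y]
  have hJ : J ⟨1, 0, 0⟩ τ = 1 := by simp [J]
  rw [hX, hY, slash, hJ] at h1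
  simpa [Finset.sum_range_succ', pow_succ] using h1

/-! ### The Oberdieck derivation -/

lemma isSingular_E1 : IsSingular E1 :=
  (hasSingularPartials_E1Deriv 0).1.congr fun _ _ hz => E1_eq hz

lemma isSingular_oberdieck (k : ℕ) {f : ℍ → ℂ → ℂ} (hf : HasSingularPartials f) :
    IsSingular (oberdieck k f) := by
  have h := ((hf.isSingular_dTau.const_mul 4).add (isSingular_E1.mul hf.1.dZ)).sub
    ((IsSingular.of_holomorphicAtInfinity ((HolomorphicAtInfinity.const k).mul
      holomorphicAtInfinity_e2)).mul hf.1)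
  exact h

/-- The normalisation gives `4 ∂_τ = -2πi ∂/∂τ`, whose factor `2πi` matches those in the
transformation laws of `E₁` and `e₂`. -/
lemma oberdieck_eq_of_hasDerivAt (k : ℕ) {f : ℍ → ℂ → ℂ} {τ : ℍ} {z x y : ℂ}
    (ht : HasDerivAt (tauSlice f z) x τ) (hz : HasDerivAt (f τ) y z) :
    oberdieck k f τ z =
      -(2 * Real.pi * Complex.I) * x + E1 τ z * y - (k : ℂ) * e2 τ * f τ z := by
  rw [oberdieck, dTau, dZ, ht.deriv, hz.deriv]
  have h4 : (4 : ℂ) * ((Real.pi : ℂ) / (2 * Complex.I) * x) = -(2 * Real.pi * Complex.I) * x := by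
    have hI := Complex.I_ne_zero
    field_simp
    rw [Complex.I_sq]
    ring
  rw [h4]

lemma oberdieck_congr (k : ℕ) {f g : ℍ → ℂ → ℂ}
    (h : ∀ (τ : ℍ) (z : ℂ), z ∉ lattice τ → f τ z = g τ z) {τ : ℍ} {z : ℂ} (hz : z ∉ lattice τ) :
    oberdieck k f τ z = oberdieck k g τ z := by
  have h1 : tauSlice f z =ᶠ[𝓝 (τ : ℂ)] tauSlice g z := by
    filter_upwards [eventually_notMem_lattice_tau hz] with t ht using h _ _ ht
  have h2 : f τ =ᶠ[𝓝 z] g τ := by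
    filter_upwards [eventually_notMem_lattice_of_notMem hz] with w hw using h _ _ hw
  rw [oberdieck, oberdieck, dTau, dTau, dZ, dZ, h1.deriv_eq, h2.deriv_eq, h τ z hz]

lemma hasDerivAt_J (A : JacobiElt) (t : ℂ) :
    HasDerivAt (fun t : ℂ => (A.g 1 0 : ℂ) * t + (A.g 1 1 : ℂ)) (A.g 1 0 : ℂ) t := by
  simpa using ((hasDerivAt_id t).const_mul (A.g 1 0 : ℂ)).add_const (A.g 1 1 : ℂ)

/-- Both arguments of `f` move with `τ`: the first with derivative `J⁻²`, the second with derivative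
`-Y/J`. The chain rule along this curve needs joint differentiability of `f`, not just partial
derivatives, which is why `HasSingularPartials` asks for a Fréchet derivative. -/
lemma hasDerivAt_tauSlice_slash (k : ℕ) {f : ℍ → ℂ → ℂ} (hf : HasSingularPartials f)
    (A : JacobiElt) {τ : ℍ} {z w : ℂ} (hz : z ∉ lattice τ)
    (hw : w = (z + (A.l : ℂ) * (τ : ℂ) + (A.m : ℂ)) / J A τ) :
    HasDerivAt (tauSlice (slash k f A) z)
      (-(k : ℂ) * X A τ * slash k f A τ z +
        (J A τ ^ (k + 2))⁻¹ * deriv (tauSlice f w) ((A.g • τ : ℍ) : ℂ) -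
        Y A τ z * ((J A τ ^ (k + 1))⁻¹ * dZ f (A.g • τ) w)) τ := by
  have hJ := J_ne_zero A τ
  have hdet := det_eq A.g
  have hw' : w ∉ lattice (A.g • τ) := by rwa [hw, slash_arg_mem_lattice_iff]
  have hJd := hasDerivAt_J A τ
  have hJτ : (A.g 1 0 : ℂ) * (τ : ℂ) + (A.g 1 1 : ℂ) = J A τ := rfl
  have hJ' : (A.g 1 0 : ℂ) * (τ : ℂ) + (A.g 1 1 : ℂ) ≠ 0 := hJ
  have h1 : HasDerivAt (fun t : ℂ => ((A.g 0 0 : ℂ) * t + (A.g 0 1 : ℂ)) /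
      ((A.g 1 0 : ℂ) * t + (A.g 1 1 : ℂ))) ((J A τ ^ 2)⁻¹) τ := by
    have hn : HasDerivAt (fun t : ℂ => (A.g 0 0 : ℂ) * t + (A.g 0 1 : ℂ)) (A.g 0 0 : ℂ) τ := by
      simpa using ((hasDerivAt_id (τ : ℂ)).const_mul (A.g 0 0 : ℂ)).add_const (A.g 0 1 : ℂ)
    refine (hn.div hJd hJ').congr_deriv ?_
    rw [hJτ, inv_eq_one_div]
    congr 1
    rw [J]
    linear_combination hdet
  have h2 : HasDerivAt (fun t : ℂ => (z + (A.l : ℂ) * t + (A.m : ℂ)) /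
      ((A.g 1 0 : ℂ) * t + (A.g 1 1 : ℂ))) (-(Y A τ z / J A τ)) τ := by
    have hn : HasDerivAt (fun t : ℂ => z + (A.l : ℂ) * t + (A.m : ℂ)) (A.l : ℂ) τ := by
      simpa using (((hasDerivAt_id (τ : ℂ)).const_mul (A.l : ℂ)).const_add z).add_const (A.m : ℂ)
    refine (hn.div hJd hJ').congr_deriv ?_
    rw [hJτ, Y]
    field_simp
    rw [J]
    ring
  have hF := hf.hasFDerivAt hw'
  have hpt : (((A.g • τ : ℍ) : ℂ), w) = ((((A.g 0 0 : ℂ) * τ + (A.g 0 1 : ℂ)) /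
      ((A.g 1 0 : ℂ) * τ + (A.g 1 1 : ℂ))), (z + (A.l : ℂ) * τ + (A.m : ℂ)) /
      ((A.g 1 0 : ℂ) * τ + (A.g 1 1 : ℂ))) := by
    rw [coe_smul_eq, hw, hJτ]
  rw [hpt] at hF
  have h3 := hF.comp_hasDerivAt (τ : ℂ) (h1.prodMk h2)
  have h4 := ((hJd.pow k).inv (pow_ne_zero k hJ')).mul h3
  refine (h4.congr_of_eventuallyEq ?_).congr_deriv ?_
  · filter_upwards [eventually_ofComplex τ] with t ht
    have ht2 : (A.g 1 0 : ℂ) * t + (A.g 1 1 : ℂ) = J A (UpperHalfPlane.ofComplex t) := by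
      rw [J, ht]
    have ht3 : ((A.g 0 0 : ℂ) * t + (A.g 0 1 : ℂ)) / J A (UpperHalfPlane.ofComplex t) =
        ((A.g • UpperHalfPlane.ofComplex t : ℍ) : ℂ) := by rw [coe_smul_eq, ht]
    simp only [tauSlice, slash, Pi.mul_apply, Pi.inv_apply, Pi.pow_apply, Function.comp, ht2, ht3,
      UpperHalfPlane.ofComplex_apply, ht]
  · simp only [linForm_apply, Pi.inv_apply, Pi.pow_apply, Function.comp, hJτ]
    have hw2 : (z + (A.l : ℂ) * (τ : ℂ) + (A.m : ℂ)) / J A τ = w := hw.symm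
    rw [← coe_smul_eq, hw2, slash, hw2, UpperHalfPlane.ofComplex_apply, X]
    -- The power rule produces the truncated exponent `k - 1`, so weight zero is separate.
    rcases k with _ | k
    · simp
      field_simp
      ring
    · simp only [Nat.add_sub_cancel]
      field_simp
      ring

lemma hasDerivAt_slash (k : ℕ) {f : ℍ → ℂ → ℂ} (hf : HasSingularPartials f)
    (A : JacobiElt) {τ : ℍ} {z w : ℂ} (hz : z ∉ lattice τ)
    (hw : w = (z + (A.l : ℂ) * (τ : ℂ) + (A.m : ℂ)) / J A τ) :
    HasDerivAt (slash k f A τ) ((J A τ ^ (k + 1))⁻¹ * dZ f (A.g • τ) w) z := by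
  have hJ := J_ne_zero A τ
  have hw' : w ∉ lattice (A.g • τ) := by rwa [hw, slash_arg_mem_lattice_iff]
  have h1 : HasDerivAt (fun z : ℂ => (z + (A.l : ℂ) * (τ : ℂ) + (A.m : ℂ)) / J A τ)
      (1 / J A τ) z :=
    (((hasDerivAt_id z).add_const _).add_const _).div_const _
  have h2 : HasDerivAt (f (A.g • τ)) (dZ f (A.g • τ) w) w :=
    (hf.1.analyticAt _ _ hw').differentiableAt.hasDerivAt
  rw [hw] at h2 ⊢
  have h3 := (HasDerivAt.comp z h2 h1).const_mul (J A τ ^ k)⁻¹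
  refine h3.congr_deriv ?_
  rw [pow_succ, mul_inv, one_div]
  ring

/-- The Oberdieck derivation commutes with the action of the Jacobi group. -/
lemma slash_oberdieck (k : ℕ) {f : ℍ → ℂ → ℂ} (hf : HasSingularPartials f) (A : JacobiElt)
    {τ : ℍ} {z : ℂ} (hz : z ∉ lattice τ) :
    slash (k + 2) (oberdieck k f) A τ z = oberdieck k (slash k f A) τ z := by
  have hJ := J_ne_zero A τ
  obtain ⟨w, hw⟩ : ∃ w, w = (z + (A.l : ℂ) * (τ : ℂ) + (A.m : ℂ)) / J A τ := ⟨_, rfl⟩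
  have hw' : w ∉ lattice (A.g • τ) := by rwa [hw, slash_arg_mem_lattice_iff]
  rw [oberdieck_eq_of_hasDerivAt k (hasDerivAt_tauSlice_slash k hf A hz hw)
    (hasDerivAt_slash k hf A hz hw)]
  -- The error `2πi Y` of `E₁` accounts for the `∂_z f` term in the `τ`-derivative of the action,
  -- and the error `-2πi X` of `e₂`, multiplied by `-k`, for the derivative of the factor `J ^
  -- (-k)`.
  have hE1 := E1_slash A hz
  have hE2 := e2_smul A τ
  rw [← hw] at hE1
  rw [div_eq_iff hJ] at hE1
  rw [div_eq_iff (pow_ne_zero 2 hJ)] at hE2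
  rw [slash, slash, ← hw, oberdieck_eq_of_hasDerivAt k
    (hasDerivAt_fst_of_linForm (hf.hasFDerivAt hw'))
    (hf.1.analyticAt _ _ hw').differentiableAt.hasDerivAt, hE1, hE2, dZ]
  field_simp
  ring

/-! ### Main result -/

lemma hasSingularPartials_of_mem_JSLe {k s₁ s₂ : ℕ} {f : ℍ → ℂ → ℂ} {q : ℕ → ℕ → ℍ → ℂ → ℂ}
    (hq : ∀ j₁ ≤ s₁, ∀ j₂ ≤ s₂, IsSingular (q j₁ j₂))
    (h : ∀ (A : JacobiElt) (τ : ℍ) (z : ℂ), z ∉ lattice τ →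
        slash k f A τ z =
          ∑ j₁ ∈ Finset.range (s₁ + 1), ∑ j₂ ∈ Finset.range (s₂ + 1),
            q j₁ j₂ τ z * X A τ ^ j₁ * Y A τ z ^ j₂) :
    (∀ j₁ ≤ s₁, ∀ j₂ ≤ s₂, HasSingularPartials (q j₁ j₂)) ∧ HasSingularPartials f := by
  have h1 : ∀ j₁ ≤ s₁, ∀ j₂ ≤ s₂, HasSingularPartials (q j₁ j₂) := fun j₁ hj₁ =>
    hasSingularPartials_of_coeffPoly (hq j₁ hj₁) fun _ _ hz => coeffPoly_add_tau h hz hj₁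
  exact ⟨h1, (h1 0 (Nat.zero_le _) 0 (Nat.zero_le _)).congr fun _ _ hz => eq_of_slash_eq h hz⟩

lemma hasDerivAt_tauSlice_X (A : JacobiElt) (τ : ℍ) :
    HasDerivAt (fun t => X A (UpperHalfPlane.ofComplex t)) (-(X A τ) ^ 2) (τ : ℂ) := by
  have hJ := J_ne_zero A τ
  have h := (hasDerivAt_const (τ : ℂ) (A.g 1 0 : ℂ)).div (hasDerivAt_J A τ) hJ
  refine (h.congr_of_eventuallyEq ?_).congr_deriv ?_
  · filter_upwards [eventually_ofComplex τ] with t ht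
    simp [X, J, ht]
  · have hJτ : (A.g 1 0 : ℂ) * (τ : ℂ) + (A.g 1 1 : ℂ) = J A τ := rfl
    rw [hJτ, X]
    field_simp
    ring

lemma hasDerivAt_tauSlice_Y (A : JacobiElt) (τ : ℍ) (z : ℂ) :
    HasDerivAt (fun t => Y A (UpperHalfPlane.ofComplex t) z) (-(X A τ * Y A τ z)) (τ : ℂ) := by
  have hJ := J_ne_zero A τ
  have h := (hasDerivAt_const (τ : ℂ)
    ((A.g 1 0 : ℂ) * z + (A.g 1 0 : ℂ) * (A.m : ℂ) - (A.g 1 1 : ℂ) * (A.l : ℂ))).div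
    (hasDerivAt_J A τ) hJ
  refine (h.congr_of_eventuallyEq ?_).congr_deriv ?_
  · filter_upwards [eventually_ofComplex τ] with t ht
    simp [Y, J, ht]
  · have hJτ : (A.g 1 0 : ℂ) * (τ : ℂ) + (A.g 1 1 : ℂ) = J A τ := rfl
    rw [hJτ, X, Y]
    field_simp
    ring

lemma hasDerivAt_Y (A : JacobiElt) (τ : ℍ) (z : ℂ) : HasDerivAt (Y A τ) (X A τ) z := by
  have h := ((((hasDerivAt_id z).const_mul (A.g 1 0 : ℂ)).add_const
    ((A.g 1 0 : ℂ) * (A.m : ℂ))).sub_const ((A.g 1 1 : ℂ) * (A.l : ℂ))).div_const (J A τ)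
  refine h.congr_deriv ?_
  rw [mul_one, X]

/-- The Oberdieck derivation of a polynomial in `X(A)` and `Y(A)`. -/
lemma oberdieck_sum (k s₁ s₂ : ℕ) {q : ℕ → ℕ → ℍ → ℂ → ℂ}
    (hq : ∀ j₁ ≤ s₁, ∀ j₂ ≤ s₂, HasSingularPartials (q j₁ j₂)) (A : JacobiElt) {τ : ℍ} {z : ℂ}
    (hz : z ∉ lattice τ) :
    oberdieck k (fun τ z => ∑ j₁ ∈ Finset.range (s₁ + 1), ∑ j₂ ∈ Finset.range (s₂ + 1),
      q j₁ j₂ τ z * X A τ ^ j₁ * Y A τ z ^ j₂) τ z =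
    ∑ j₁ ∈ Finset.range (s₁ + 1), ∑ j₂ ∈ Finset.range (s₂ + 1),
      (oberdieck k (q j₁ j₂) τ z * X A τ ^ j₁ * Y A τ z ^ j₂ +
        (2 * Real.pi * Complex.I * ((j₁ : ℂ) + j₂)) * q j₁ j₂ τ z * X A τ ^ (j₁ + 1) *
          Y A τ z ^ j₂ +
        (j₂ : ℂ) * E1 τ z * q j₁ j₂ τ z * X A τ ^ (j₁ + 1) * Y A τ z ^ (j₂ - 1)) := by
  have hX := hasDerivAt_tauSlice_X A τ
  have hY := hasDerivAt_tauSlice_Y A τ z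
  have hYz := hasDerivAt_Y A τ z
  have hmem : ∀ {j s : ℕ}, j ∈ Finset.range (s + 1) → j ≤ s := fun h => by
    simpa [Nat.lt_succ_iff] using h
  have ht := fun j₁ (h₁ : j₁ ∈ Finset.range (s₁ + 1)) j₂ (h₂ : j₂ ∈ Finset.range (s₂ + 1)) =>
    ((hasDerivAt_fst_of_linForm ((hq j₁ (hmem h₁) j₂ (hmem h₂)).hasFDerivAt hz)).mul
      (hX.pow j₁)).mul (hY.pow j₂)
  have hzz := fun j₁ (h₁ : j₁ ∈ Finset.range (s₁ + 1)) j₂ (h₂ : j₂ ∈ Finset.range (s₂ + 1)) =>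
    ((((hq j₁ (hmem h₁) j₂ (hmem h₂)).1.analyticAt _ _ hz).differentiableAt.hasDerivAt).mul_const
      (X A τ ^ j₁)).mul (hYz.pow j₂)
  have ht' := HasDerivAt.fun_sum fun j₁ h₁ => HasDerivAt.fun_sum fun j₂ h₂ => ht j₁ h₁ j₂ h₂
  have hz' := HasDerivAt.fun_sum fun j₁ h₁ => HasDerivAt.fun_sum fun j₂ h₂ => hzz j₁ h₁ j₂ h₂
  rw [oberdieck_eq_of_hasDerivAt k (f := fun τ z => ∑ j₁ ∈ Finset.range (s₁ + 1),
    ∑ j₂ ∈ Finset.range (s₂ + 1), q j₁ j₂ τ z * X A τ ^ j₁ * Y A τ z ^ j₂) ht' hz', Finset.mul_sum,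
    Finset.mul_sum, Finset.mul_sum,
    ← Finset.sum_add_distrib, ← Finset.sum_sub_distrib]
  refine Finset.sum_congr rfl fun j₁ h₁ => ?_
  rw [Finset.mul_sum, Finset.mul_sum, Finset.mul_sum,
    ← Finset.sum_add_distrib, ← Finset.sum_sub_distrib]
  refine Finset.sum_congr rfl fun j₂ h₂ => ?_
  rw [oberdieck_eq_of_hasDerivAt k
    (hasDerivAt_fst_of_linForm ((hq j₁ (hmem h₁) j₂ (hmem h₂)).hasFDerivAt hz))
    ((hq j₁ (hmem h₁) j₂ (hmem h₂)).1.analyticAt _ _ hz).differentiableAt.hasDerivAt]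
  simp only [UpperHalfPlane.ofComplex_apply, Pi.mul_apply, Pi.pow_apply]
  -- The cases `j = 0` are split off because of the truncated exponents `j - 1`; there the factor
  -- `j` vanishes.
  rcases j₁ with _ | j₁ <;> rcases j₂ with _ | j₂ <;>
    simp only [Nat.add_sub_cancel, Nat.zero_sub, Nat.cast_zero, pow_zero] <;> push_cast <;> ring

/-- The coefficients of `X(A)^(j₁ + 1) Y(A)^j₂` that arise from differentiating the powers of
`X(A)` and `Y(A)`. -/
def shiftedCoeff (s₂ : ℕ) (q : ℕ → ℕ → ℍ → ℂ → ℂ) (j₁ j₂ : ℕ) (τ : ℍ) (z : ℂ) : ℂ :=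
  2 * Real.pi * Complex.I * ((j₁ : ℂ) + j₂) * q j₁ j₂ τ z +
    if j₂ < s₂ then ((j₂ : ℂ) + 1) * (E1 τ z * q j₁ (j₂ + 1) τ z) else 0

/-- The coefficients of the Oberdieck derivative of a quasi-Jacobi form. -/
def oberdieckCoeff (k s₁ s₂ : ℕ) (q : ℕ → ℕ → ℍ → ℂ → ℂ) (j₁ j₂ : ℕ) (τ : ℍ) (z : ℂ) : ℂ :=
  (if j₁ ≤ s₁ then oberdieck k (q j₁ j₂) τ z else 0) +
    if 1 ≤ j₁ then shiftedCoeff s₂ q (j₁ - 1) j₂ τ z else 0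

lemma isSingular_oberdieckCoeff (k : ℕ) {s₁ s₂ : ℕ} {q : ℕ → ℕ → ℍ → ℂ → ℂ}
    (hq : ∀ j₁ ≤ s₁, ∀ j₂ ≤ s₂, HasSingularPartials (q j₁ j₂)) {j₁ j₂ : ℕ} (h₁ : j₁ ≤ s₁ + 1)
    (h₂ : j₂ ≤ s₂) : IsSingular (oberdieckCoeff k s₁ s₂ q j₁ j₂) := by
  refine IsSingular.add ?_ ?_
  · split_ifs with h
    · exact isSingular_oberdieck k (hq j₁ h j₂ h₂)
    · exact IsSingular.const 0
  · split_ifs with h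
    · refine IsSingular.add ((hq (j₁ - 1) (by lia) j₂ h₂).1.const_mul _) ?_
      split_ifs with h'
      · exact (isSingular_E1.mul (hq (j₁ - 1) (by lia) (j₂ + 1) h').1).const_mul _
      · exact IsSingular.const 0
    · exact IsSingular.const 0

lemma sum_oberdieckCoeff (k s₁ s₂ : ℕ) (q : ℕ → ℕ → ℍ → ℂ → ℂ) (τ : ℍ) (z x y : ℂ) :
    ∑ j₁ ∈ Finset.range (s₁ + 1 + 1), ∑ j₂ ∈ Finset.range (s₂ + 1),
      oberdieckCoeff k s₁ s₂ q j₁ j₂ τ z * x ^ j₁ * y ^ j₂ =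
    ∑ j₁ ∈ Finset.range (s₁ + 1), ∑ j₂ ∈ Finset.range (s₂ + 1),
      (oberdieck k (q j₁ j₂) τ z * x ^ j₁ * y ^ j₂ +
        (2 * Real.pi * Complex.I * ((j₁ : ℂ) + j₂)) * q j₁ j₂ τ z * x ^ (j₁ + 1) * y ^ j₂ +
        (j₂ : ℂ) * E1 τ z * q j₁ j₂ τ z * x ^ (j₁ + 1) * y ^ (j₂ - 1)) := by
  -- Lowering the exponent of `Y` shifts the index `j₂`: the term `j₂ = 0` vanishes, and no
  -- coefficient reaches the top degree `s₂`. The elliptic depth therefore does not grow.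
  have hshift : ∀ j₁, ∑ j₂ ∈ Finset.range (s₂ + 1),
      (j₂ : ℂ) * E1 τ z * q j₁ j₂ τ z * x ^ (j₁ + 1) * y ^ (j₂ - 1) =
      ∑ j₂ ∈ Finset.range (s₂ + 1), (if j₂ < s₂ then
        ((j₂ : ℂ) + 1) * (E1 τ z * q j₁ (j₂ + 1) τ z) else 0) * x ^ (j₁ + 1) * y ^ j₂ := by
    intro j₁
    rw [Finset.sum_range_succ', Finset.sum_range_succ, if_neg (lt_irrefl s₂)]
    simp only [Nat.cast_zero, zero_mul, add_zero]
    refine Finset.sum_congr rfl fun j₂ h₂ => ?_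
    rw [if_pos (Finset.mem_range.1 h₂), Nat.add_sub_cancel]
    push_cast
    ring
  have hleft : ∑ j₁ ∈ Finset.range (s₁ + 1 + 1), ∑ j₂ ∈ Finset.range (s₂ + 1),
      (if j₁ ≤ s₁ then oberdieck k (q j₁ j₂) τ z else 0) * x ^ j₁ * y ^ j₂ =
      ∑ j₁ ∈ Finset.range (s₁ + 1), ∑ j₂ ∈ Finset.range (s₂ + 1),
        oberdieck k (q j₁ j₂) τ z * x ^ j₁ * y ^ j₂ := by
    rw [Finset.sum_range_succ _ (s₁ + 1)]
    simp only [if_neg (by lia : ¬s₁ + 1 ≤ s₁), zero_mul, Finset.sum_const_zero, add_zero]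
    refine Finset.sum_congr rfl fun j₁ h₁ => Finset.sum_congr rfl fun j₂ _ => ?_
    rw [if_pos (by simpa [Nat.lt_succ_iff] using h₁)]
  have hright : ∑ j₁ ∈ Finset.range (s₁ + 1 + 1), ∑ j₂ ∈ Finset.range (s₂ + 1),
      (if 1 ≤ j₁ then shiftedCoeff s₂ q (j₁ - 1) j₂ τ z else 0) * x ^ j₁ * y ^ j₂ =
      ∑ j₁ ∈ Finset.range (s₁ + 1), ∑ j₂ ∈ Finset.range (s₂ + 1),
        shiftedCoeff s₂ q j₁ j₂ τ z * x ^ (j₁ + 1) * y ^ j₂ := by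
    rw [Finset.sum_range_succ' _ (s₁ + 1)]
    simp only [if_neg (by lia : ¬1 ≤ 0), zero_mul, Finset.sum_const_zero, add_zero]
    refine Finset.sum_congr rfl fun j₁ _ => Finset.sum_congr rfl fun j₂ _ => ?_
    rw [if_pos (by lia), Nat.add_sub_cancel]
  calc _ = ∑ j₁ ∈ Finset.range (s₁ + 1 + 1), ∑ j₂ ∈ Finset.range (s₂ + 1),
        (if j₁ ≤ s₁ then oberdieck k (q j₁ j₂) τ z else 0) * x ^ j₁ * y ^ j₂ +
      ∑ j₁ ∈ Finset.range (s₁ + 1 + 1), ∑ j₂ ∈ Finset.range (s₂ + 1),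
        (if 1 ≤ j₁ then shiftedCoeff s₂ q (j₁ - 1) j₂ τ z else 0) * x ^ j₁ * y ^ j₂ := by
        simp only [oberdieckCoeff, add_mul _ _ (x ^ _), add_mul _ _ (y ^ _),
          Finset.sum_add_distrib]
    _ = _ := by
      rw [hleft, hright, ← Finset.sum_add_distrib]
      refine Finset.sum_congr rfl fun j₁ _ => ?_
      rw [Finset.sum_add_distrib, Finset.sum_add_distrib, hshift, ← Finset.sum_add_distrib,
        ← Finset.sum_add_distrib, ← Finset.sum_add_distrib]
      refine Finset.sum_congr rfl fun j₂ _ => ?_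
      rw [shiftedCoeff]
      ring

end QuasiJacobi

end

theorem proposition28 :
    (∀ (k s₁ s₂ : ℕ) (f : ℍ → ℂ → ℂ), f ∈ QuasiJacobi.JSLe k s₁ s₂ →
      QuasiJacobi.HasPartials f ∧
        QuasiJacobi.oberdieck k f ∈ QuasiJacobi.JSLe (k + 2) (s₁ + 1) s₂) ∧
    (∀ (k : ℕ) (f : ℍ → ℂ → ℂ), f ∈ QuasiJacobi.JS k →
      QuasiJacobi.HasPartials f ∧
        QuasiJacobi.oberdieck k f ∈ QuasiJacobi.JS (k + 2)) := by
  open QuasiJacobi in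
  refine ⟨?_, ?_⟩
  · rintro k s₁ s₂ f ⟨-, q, hq, h⟩
    obtain ⟨hqs, hf⟩ := hasSingularPartials_of_mem_JSLe hq h
    refine ⟨hf.hasPartials, isSingular_oberdieck k hf, oberdieckCoeff k s₁ s₂ q,
      fun j₁ h₁ j₂ h₂ => isSingular_oberdieckCoeff k hqs h₁ h₂, fun A τ z hz => ?_⟩
    -- Inside the derivation, `slash k f A` may be replaced by its expansion, since the two agree on
    -- the open set of points off the lattices.
    rw [slash_oberdieck k hf A hz, oberdieck_congr k (fun τ z hz => h A τ z hz) hz,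
      oberdieck_sum k s₁ s₂ hqs A hz, sum_oberdieckCoeff]
  · rintro k f ⟨hs, h⟩
    -- An invariant form is a quasi-Jacobi form of depth `(0, 0)` with itself as its only
    -- coefficient.
    have hf : HasSingularPartials f :=
      (hasSingularPartials_of_mem_JSLe (k := k) (s₁ := 0) (s₂ := 0) (q := fun _ _ => f)
        (fun _ _ _ _ => hs) fun A τ z hz => by simp [h A τ z hz]).2
    refine ⟨hf.hasPartials, isSingular_oberdieck k hf, fun A τ z hz => ?_⟩
    rw [slash_oberdieck k hf A hz, oberdieck_congr k (fun τ z hz => h A τ z hz) hz]
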